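/- Identify $\mathbb{R}^2$ with $\mathbb{C}$, $z=x_1+ix_2=re^{i\theta}$, and write $\wedge$ for the cross product in $\mathbb{R}^3$. Let $\Pi(z)=\frac{1}{1+|z|^2}(2\,\mathrm{Re}\,z,\,2\,\mathrm{Im}\,z,\,|z|^2-1)$ and $\Pi'(z)=\frac{1}{1+|z|^2}(2\,\mathrm{Re}\,z,\,2\,\mathrm{Im}\,z,\,1-|z|^2)$. For an integer $m\neq 0$ put $n=|m|$, and let $W^{(m)}(z)=\Pi(z^m)$ if $m\ge 1$ and $W^{(m)}(z)=\Pi'(\bar z^{\,|m|})$ if $m\le -1$. **Theorem (non-degeneracy of $H$-bubbles).** Let $m\ne 0$ be an integer and $n=|m|$. The map $W^{(m)}:\mathbb{R}^2\to\mathbb{R}^3$ is a $C^2$ solution of $$\Delta u=2\,u_{x_1}\wedge u_{x_2}\quad\text{in }\mathbb{R}^2,$$ and for $r>0$, $\theta\in\mathbb{R}$ it is given in polar coordinates by $$W^{(m)}(r,\theta)=\Big(\tfrac{2r^m\cos(m\theta)}{r^{2m}+1},\ \tfrac{2r^m\sin(m\theta)}{r^{2m}+1},\ \tfrac{r^{2m}-1}{r^{2m}+1}\Big).$$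 It is non-degenerate in the following sense: every bounded $C^2$ solution $\phi:\mathbb{R}^2\to\mathbb{R}^3$ of the linearized equation $$\Delta\phi=2\left(W^{(m)}_{x_1}\wedge\phi_{x_2}+\phi_{x_1}\wedge W^{(m)}_{x_2}\right)\quad\text{in }\mathbb{R}^2$$ is, in polar coordinates $r>0$, $\theta\in\mathbb{R}$, a linear combination with real constant coefficients of the following $4n+5$ functions: $$\frac{r^{2n}-1}{r^{2n}+1}W^{(m)},\quad \frac{r^{n}}{1+r^{2n}}\cos(n\theta)\,W^{(m)},\quad \frac{r^{n}}{1+r^{2n}}\sin(n\theta)\,W^{(m)},$$ $$\frac{r^{n-k}}{1+r^{2n}}\left(\cos(k\theta)E_1^{(m)}+\sin(k\theta)E_2^{(m)}\right),\quad \frac{r^{n-k}}{1+r^{2n}}\left(\sin(k\theta)E_1^{(m)}-\cos(k\theta)E_2^{(m)}\right),\qquad k=0,1,\dots,n,$$ $$\frac{r^{n+l}}{1+r^{2n}}\left(\cos(l\theta)E_1^{(m)}-\sin(l\theta)E_2^{(m)}\right),\quad \frac{r^{n+l}}{1+r^{2n}}\left(\sin(l\theta)E_1^{(m)}+\cos(l\theta)E_2^{(m)}\right),\qquad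 l=1,\dots,n,$$ where $$E_1^{(m)}(r,\theta)=\Big(\tfrac{r^{2m}-1}{r^{2m}+1}\cos(m\theta),\ \tfrac{r^{2m}-1}{r^{2m}+1}\sin(m\theta),\ \tfrac{-2r^m}{r^{2m}+1}\Big),\qquad E_2^{(m)}(r,\theta)=\big(-\sin(m\theta),\ \cos(m\theta),\ 0\big).$$ -/

import Mathlib

open scoped Laplacian Matrix

noncomputable section

namespace HBubble

/-- Partial derivative `u_{x₁}` of a map on the plane `ℝ² = ℂ`, `x = x₁ + i x₂`. -/
def dx₁ (u : ℂ → Fin 3 → ℝ) (z : ℂ) : Fin 3 → ℝ := fderiv ℝ u z 1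

/-- Partial derivative `u_{x₂}` of a map on the plane `ℝ² = ℂ`, `x = x₁ + i x₂`. -/
def dx₂ (u : ℂ → Fin 3 → ℝ) (z : ℂ) : Fin 3 → ℝ := fderiv ℝ u z Complex.I

/-- `u` is an entire classical solution of the `H`-system `Δu = 2 u_{x₁} ∧ u_{x₂}`. -/
def SolvesHSystem (u : ℂ → Fin 3 → ℝ) : Prop :=
  ContDiff ℝ 2 u ∧ ∀ z, (Δ u) z = (2 : ℝ) • (dx₁ u z ⨯₃ dx₂ u z)

/-- `φ` is an entire classical solution of the linearization of the `H`-system around `W`,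
`Δφ = 2 (W_{x₁} ∧ φ_{x₂} + φ_{x₁} ∧ W_{x₂})`. -/
def SolvesLinearized (W φ : ℂ → Fin 3 → ℝ) : Prop :=
  ContDiff ℝ 2 φ ∧
    ∀ z, (Δ φ) z = (2 : ℝ) • (dx₁ W z ⨯₃ dx₂ φ z + dx₁ φ z ⨯₃ dx₂ W z)

/-- `φ` is bounded on the plane. -/
def IsBoundedMap (φ : ℂ → Fin 3 → ℝ) : Prop := ∃ C : ℝ, ∀ z, ‖φ z‖ ≤ C

/-- Inverse stereographic projection `Π(z) = (2z, |z|² - 1) / (1 + |z|²)`. -/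
def stereoInv (z : ℂ) : Fin 3 → ℝ :=
  (1 / (1 + ‖z‖ ^ 2)) • ![2 * z.re, 2 * z.im, ‖z‖ ^ 2 - 1]

/-- The other inverse stereographic projection `Π'(z) = (2z, 1 - |z|²) / (1 + |z|²)`. -/
def stereoInv' (z : ℂ) : Fin 3 → ℝ :=
  (1 / (1 + ‖z‖ ^ 2)) • ![2 * z.re, 2 * z.im, 1 - ‖z‖ ^ 2]

/-- The bubble `W⁽ᵐ⁾` of degree `m ≠ 0`: `Π(z ^ m)` for `m ≥ 1` and `Π'(z̄ ^ |m|)` for `m ≤ -1`. -/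
def bubble (m : ℤ) (z : ℂ) : Fin 3 → ℝ :=
  if 0 < m then stereoInv (z ^ m.natAbs) else stereoInv' ((starRingEnd ℂ z) ^ m.natAbs)

/-- The point of the plane with polar coordinates `(r, θ)`. -/
def polarPt (r θ : ℝ) : ℂ := r * Complex.exp (θ * Complex.I)

/-- The first frame vector `E₁⁽ᵐ⁾` at the point with polar coordinates `(r, θ)`, `r > 0`. -/
def frame₁ (m : ℤ) (r θ : ℝ) : Fin 3 → ℝ :=
  ![(r ^ (2 * m) - 1) / (r ^ (2 * m) + 1) * Real.cos (m * θ),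
    (r ^ (2 * m) - 1) / (r ^ (2 * m) + 1) * Real.sin (m * θ),
    -2 * r ^ m / (r ^ (2 * m) + 1)]

/-- The second frame vector `E₂⁽ᵐ⁾` at the point with polar coordinates `(r, θ)`. -/
def frame₂ (m : ℤ) (_r θ : ℝ) : Fin 3 → ℝ :=
  ![-Real.sin (m * θ), Real.cos (m * θ), 0]

/-- Labels of the `4n + 5` kernel functions. -/
inductive KernelIndex (n : ℕ) : Type
  /-- The three functions along the bubble. -/
  | along (i : Fin 3)
  /-- Two functions with weight `r ^ (n - k)` for each `k = 0, …, n`. -/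
  | lower (k : Fin (n + 1)) (j : Fin 2)
  /-- Two functions with weight `r ^ (n + l)`; the label `l' : Fin n` stands for
  `l = l' + 1 = 1, …, n`. -/
  | upper (l' : Fin n) (j : Fin 2)

/-- The labels as a disjoint union. -/
def KernelIndex.equivSum (n : ℕ) :
    KernelIndex n ≃ Fin 3 ⊕ (Fin (n + 1) × Fin 2) ⊕ (Fin n × Fin 2) where
  toFun
    | .along i => .inl i
    | .lower k j => .inr (.inl (k, j))
    | .upper l j => .inr (.inr (l, j))
  invFun
    | .inl i => .along i
    | .inr (.inl (k, j)) => .lower k j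
    | .inr (.inr (l, j)) => .upper l j
  left_inv x := by cases x <;> rfl
  right_inv x := by rcases x with i | ⟨k, j⟩ | ⟨l, j⟩ <;> rfl

instance (n : ℕ) : Fintype (KernelIndex n) := Fintype.ofEquiv _ (KernelIndex.equivSum n).symm

/-- There are `4n + 5` labels. -/
theorem KernelIndex.card (n : ℕ) : Fintype.card (KernelIndex n) = 4 * n + 5 := by
  rw [Fintype.card_congr (KernelIndex.equivSum n)]
  simp
  ring

/-- The kernel functions of degree `m ≠ 0`, in polar coordinates `(r, θ)`, `r > 0`.
With `n = |m|`, the radial weights and the ranges of `k`, `l` are those of `n`, while the bubble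
and the frame are `W⁽ᵐ⁾`, `E₁⁽ᵐ⁾`, `E₂⁽ᵐ⁾`. -/
def kernelFun (m : ℤ) : KernelIndex m.natAbs → ℝ → ℝ → Fin 3 → ℝ
  | .along 0, r, θ =>
      ((r ^ (2 * m.natAbs) - 1) / (r ^ (2 * m.natAbs) + 1)) • bubble m (polarPt r θ)
  | .along 1, r, θ =>
      (r ^ m.natAbs / (1 + r ^ (2 * m.natAbs)) * Real.cos (m.natAbs * θ)) •
        bubble m (polarPt r θ)
  | .along 2, r, θ =>
      (r ^ m.natAbs / (1 + r ^ (2 * m.natAbs)) * Real.sin (m.natAbs * θ)) •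
        bubble m (polarPt r θ)
  | .lower k 0, r, θ =>
      (r ^ (m.natAbs - (k : ℕ)) / (1 + r ^ (2 * m.natAbs))) •
        (Real.cos ((k : ℕ) * θ) • frame₁ m r θ + Real.sin ((k : ℕ) * θ) • frame₂ m r θ)
  | .lower k 1, r, θ =>
      (r ^ (m.natAbs - (k : ℕ)) / (1 + r ^ (2 * m.natAbs))) •
        (Real.sin ((k : ℕ) * θ) • frame₁ m r θ - Real.cos ((k : ℕ) * θ) • frame₂ m r θ)
  | .upper l' 0, r, θ =>
      (r ^ (m.natAbs + ((l' : ℕ) + 1)) / (1 + r ^ (2 * m.natAbs))) •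
        (Real.cos (((l' : ℕ) + 1 : ℕ) * θ) • frame₁ m r θ -
          Real.sin (((l' : ℕ) + 1 : ℕ) * θ) • frame₂ m r θ)
  | .upper l' 1, r, θ =>
      (r ^ (m.natAbs + ((l' : ℕ) + 1)) / (1 + r ^ (2 * m.natAbs))) •
        (Real.sin (((l' : ℕ) + 1 : ℕ) * θ) • frame₁ m r θ +
          Real.cos (((l' : ℕ) + 1 : ℕ) * θ) • frame₂ m r θ)

end HBubble

end

open scoped Laplacian Matrix

noncomputable section

namespace HBubble

/-! In logarithmic polar coordinates s = log r, t = θ, conformality turns the plane equation into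
F_ss + F_tt = 2 (W_s ∧ F_t + F_s ∧ W_t) on a cylinder (`laplacian_polar`, `cross_polar`), with
coefficients built from sech(ms) and tanh(ms) only. The frame W, E₁, E₂ is orthonormal there, with
W_s = -m sech(ms) E₁ and W_t = m sech(ms) E₂. Only pure second derivatives enter, so a jet records
no mixed one.

Projecting on the frame splits the system. The component η along W decouples: η_ss + η_tt = -2 m²
sech²(ms) η. The components p, q along E₁, E₂ combine into X = -p + i q, which solves the single
complex equation X_ss + X_tt = m² (tanh² - sech²) X + 2 i m tanh(ms) X_t.

Fourier modes in t then solve ordinary differential equations that factor explicitly. For η, y'' =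
(k² - 2 m² sech²) y is the one-soliton Schrödinger equation; the Darboux transform y' + m tanh(ms) y
reduces it to ζ'' = k² ζ, and boundedness on the whole line leaves tanh for k = 0, sech for k = ±m,
and nothing else (`bounded_solution_normal_zero`, `bounded_solution_normal`). For X, y'' = (g² + g')
y with g = k - m tanh(ms), which is (∂ + g)(∂ - g) y = 0; boundedness forces y' = g y, hence y = d
e^{ks} sech(ms), and then |k| ≤ |m| (`bounded_solution_tangential`).

So only finitely many modes survive, and a continuous periodic function with finitely many modes is
their sum (`eq_sum_modes`). The real dimensions are 3 for η and 2 (2n + 1) for X, in total 4n + 5;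
since sech(ms) = 2 rⁿ / (1 + r²ⁿ), these are the listed functions up to constants. -/

/-- The functions `us`, `ut`, `uss`, `utt` are the first and second pure partial derivatives of
the function `u` of two real variables, and all of them are jointly continuous. -/
structure IsJet {E : Type*} [NormedAddCommGroup E] [NormedSpace ℝ E]
    (u us ut uss utt : ℝ → ℝ → E) : Prop where
  s : ∀ s t, HasDerivAt (fun s => u s t) (us s t) s
  t : ∀ s t, HasDerivAt (fun t => u s t) (ut s t) t
  ss : ∀ s t, HasDerivAt (fun s => us s t) (uss s t) s
  tt : ∀ s t, HasDerivAt (fun t => ut s t) (utt s t) t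
  cont : Continuous fun p : ℝ × ℝ => u p.1 p.2
  cont_s : Continuous fun p : ℝ × ℝ => us p.1 p.2
  cont_t : Continuous fun p : ℝ × ℝ => ut p.1 p.2
  cont_ss : Continuous fun p : ℝ × ℝ => uss p.1 p.2
  cont_tt : Continuous fun p : ℝ × ℝ => utt p.1 p.2

/-! ### Calculus of jets in two real variables -/

namespace IsJet

variable {E F : Type*} [NormedAddCommGroup E] [NormedSpace ℝ E]
  [NormedAddCommGroup F] [NormedSpace ℝ F]
  {u us ut uss utt v vs vt vss vtt : ℝ → ℝ → E}

theorem clm (L : E →L[ℝ] F) (h : IsJet u us ut uss utt) :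
    IsJet (fun s t => L (u s t)) (fun s t => L (us s t)) (fun s t => L (ut s t))
      (fun s t => L (uss s t)) (fun s t => L (utt s t)) where
  s s t := L.hasFDerivAt.comp_hasDerivAt s (h.s s t)
  t s t := L.hasFDerivAt.comp_hasDerivAt t (h.t s t)
  ss s t := L.hasFDerivAt.comp_hasDerivAt s (h.ss s t)
  tt s t := L.hasFDerivAt.comp_hasDerivAt t (h.tt s t)
  cont := L.continuous.comp h.cont
  cont_s := L.continuous.comp h.cont_s
  cont_t := L.continuous.comp h.cont_t
  cont_ss := L.continuous.comp h.cont_ss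
  cont_tt := L.continuous.comp h.cont_tt

theorem add (h : IsJet u us ut uss utt) (k : IsJet v vs vt vss vtt) :
    IsJet (fun s t => u s t + v s t) (fun s t => us s t + vs s t) (fun s t => ut s t + vt s t)
      (fun s t => uss s t + vss s t) (fun s t => utt s t + vtt s t) where
  s s t := (h.s s t).add (k.s s t)
  t s t := (h.t s t).add (k.t s t)
  ss s t := (h.ss s t).add (k.ss s t)
  tt s t := (h.tt s t).add (k.tt s t)
  cont := h.cont.add k.cont
  cont_s := h.cont_s.add k.cont_s
  cont_t := h.cont_t.add k.cont_t
  cont_ss := h.cont_ss.add k.cont_ss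
  cont_tt := h.cont_tt.add k.cont_tt

theorem mul {A : Type*} [NormedRing A] [NormedAlgebra ℝ A]
    {u us ut uss utt v vs vt vss vtt : ℝ → ℝ → A}
    (h : IsJet u us ut uss utt) (k : IsJet v vs vt vss vtt) :
    IsJet (fun s t => u s t * v s t) (fun s t => us s t * v s t + u s t * vs s t)
      (fun s t => ut s t * v s t + u s t * vt s t)
      (fun s t => (uss s t * v s t + us s t * vs s t) + (us s t * vs s t + u s t * vss s t))
      (fun s t => (utt s t * v s t + ut s t * vt s t) + (ut s t * vt s t + u s t * vtt s t)) where
  s s t := (h.s s t).mul (k.s s t)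
  t s t := (h.t s t).mul (k.t s t)
  ss s t := ((h.ss s t).mul (k.s s t)).add ((h.s s t).mul (k.ss s t))
  tt s t := ((h.tt s t).mul (k.t s t)).add ((h.t s t).mul (k.tt s t))
  cont := h.cont.mul k.cont
  cont_s := (h.cont_s.mul k.cont).add (h.cont.mul k.cont_s)
  cont_t := (h.cont_t.mul k.cont).add (h.cont.mul k.cont_t)
  cont_ss := ((h.cont_ss.mul k.cont).add (h.cont_s.mul k.cont_s)).add
    ((h.cont_s.mul k.cont_s).add (h.cont.mul k.cont_ss))
  cont_tt := ((h.cont_tt.mul k.cont).add (h.cont_t.mul k.cont_t)).add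
    ((h.cont_t.mul k.cont_t).add (h.cont.mul k.cont_tt))

theorem of_left {f f' f'' : ℝ → E} (h : ∀ s, HasDerivAt f (f' s) s)
    (h' : ∀ s, HasDerivAt f' (f'' s) s) (hc : Continuous f'') :
    IsJet (fun s _ => f s) (fun s _ => f' s) (fun _ _ => 0) (fun s _ => f'' s) (fun _ _ => 0) where
  s s _ := h s
  t _ _ := hasDerivAt_const _ _
  ss s _ := h' s
  tt _ _ := hasDerivAt_const _ _
  cont := (continuous_iff_continuousAt.2 fun s => (h s).continuousAt).comp continuous_fst
  cont_s := (continuous_iff_continuousAt.2 fun s => (h' s).continuousAt).comp continuous_fst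
  cont_t := continuous_const
  cont_ss := hc.comp continuous_fst
  cont_tt := continuous_const

theorem of_right {f f' f'' : ℝ → E} (h : ∀ s, HasDerivAt f (f' s) s)
    (h' : ∀ s, HasDerivAt f' (f'' s) s) (hc : Continuous f'') :
    IsJet (fun _ t => f t) (fun _ _ => 0) (fun _ t => f' t) (fun _ _ => 0) (fun _ t => f'' t) where
  s _ _ := hasDerivAt_const _ _
  t _ t := h t
  ss _ _ := hasDerivAt_const _ _
  tt _ t := h' t
  cont := (continuous_iff_continuousAt.2 fun s => (h s).continuousAt).comp continuous_snd
  cont_t := (continuous_iff_continuousAt.2 fun s => (h' s).continuousAt).comp continuous_snd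
  cont_s := continuous_const
  cont_tt := hc.comp continuous_snd
  cont_ss := continuous_const

/-- The partial derivatives in a jet are determined by the function. -/
theorem unique (h : IsJet u us ut uss utt) (k : IsJet u vs vt vss vtt) :
    us = vs ∧ ut = vt ∧ uss = vss ∧ utt = vtt := by
  have h1 : us = vs := by ext s t; exact (h.s s t).unique (k.s s t)
  have h2 : ut = vt := by ext s t; exact (h.t s t).unique (k.t s t)
  subst h1 h2
  exact ⟨rfl, rfl, by ext s t; exact (h.ss s t).unique (k.ss s t),
    by ext s t; exact (h.tt s t).unique (k.tt s t)⟩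

end IsJet

/-! ### Logarithmic polar coordinates -/

theorem polarPt_exp_s (s t : ℝ) :
    HasDerivAt (fun s => polarPt (Real.exp s) t) (polarPt (Real.exp s) t) s := by
  unfold polarPt
  exact ((Real.hasDerivAt_exp s).ofReal_comp).mul_const _

theorem polarPt_exp_t (s t : ℝ) :
    HasDerivAt (fun t => polarPt (Real.exp s) t) (Complex.I * polarPt (Real.exp s) t) t := by
  unfold polarPt
  have h : HasDerivAt (fun t : ℝ => (t : ℂ) * Complex.I) (1 * Complex.I) t :=
    (Complex.ofRealCLM.hasDerivAt (x := t)).mul_const _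
  refine ((h.cexp).const_mul ((Real.exp s : ℝ) : ℂ)).congr_deriv ?_
  ring

theorem continuous_polarPt_exp : Continuous fun p : ℝ × ℝ => polarPt (Real.exp p.1) p.2 := by
  unfold polarPt
  fun_prop

/-- The jet of a `C²` map of the plane in logarithmic polar coordinates. -/
theorem isJet_polar {E : Type*} [NormedAddCommGroup E] [NormedSpace ℝ E] {f : ℂ → E}
    (hf : ContDiff ℝ 2 f) :
    IsJet (fun s t => f (polarPt (Real.exp s) t))
      (fun s t => fderiv ℝ f (polarPt (Real.exp s) t) (polarPt (Real.exp s) t))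
      (fun s t => fderiv ℝ f (polarPt (Real.exp s) t) (Complex.I * polarPt (Real.exp s) t))
      (fun s t => fderiv ℝ (fderiv ℝ f) (polarPt (Real.exp s) t) (polarPt (Real.exp s) t)
          (polarPt (Real.exp s) t) +
        fderiv ℝ f (polarPt (Real.exp s) t) (polarPt (Real.exp s) t))
      (fun s t => fderiv ℝ (fderiv ℝ f) (polarPt (Real.exp s) t)
          (Complex.I * polarPt (Real.exp s) t) (Complex.I * polarPt (Real.exp s) t) +
        fderiv ℝ f (polarPt (Real.exp s) t)
          (Complex.I * (Complex.I * polarPt (Real.exp s) t))) := by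
  have d1 : ∀ z, HasFDerivAt f (fderiv ℝ f z) z := fun z =>
    (hf.differentiable (by norm_num) z).hasFDerivAt
  have hf1 : ContDiff ℝ 1 (fderiv ℝ f) := hf.fderiv_right (by norm_num)
  have d2 : ∀ z, HasFDerivAt (fderiv ℝ f) (fderiv ℝ (fderiv ℝ f) z) z := fun z =>
    (hf1.differentiable (by norm_num) z).hasFDerivAt
  have hf2 : Continuous (fderiv ℝ (fderiv ℝ f)) := hf1.continuous_fderiv (by norm_num)
  have cz := continuous_polarPt_exp
  have cIz : Continuous fun p : ℝ × ℝ => Complex.I * polarPt (Real.exp p.1) p.2 :=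
    continuous_const.mul cz
  have c1 := hf1.continuous.comp cz
  have c2 := hf2.comp cz
  exact
  { s := fun s t => (d1 _).comp_hasDerivAt s (polarPt_exp_s s t)
    t := fun s t => (d1 _).comp_hasDerivAt t (polarPt_exp_t s t)
    ss := fun s t => ((d2 _).comp_hasDerivAt s (polarPt_exp_s s t)).clm_apply (polarPt_exp_s s t)
    tt := fun s t => ((d2 _).comp_hasDerivAt t (polarPt_exp_t s t)).clm_apply
      ((polarPt_exp_t s t).const_mul _)
    cont := hf.continuous.comp cz
    cont_s := c1.clm_apply cz
    cont_t := c1.clm_apply cIz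
    cont_ss := ((c2.clm_apply cz).clm_apply cz).add (c1.clm_apply cz)
    cont_tt := ((c2.clm_apply cIz).clm_apply cIz).add
      (c1.clm_apply (continuous_const.mul cIz)) }

theorem clm_apply_re_im {E : Type*} [NormedAddCommGroup E] [NormedSpace ℝ E] (L : ℂ →L[ℝ] E)
    (z : ℂ) : L z = z.re • L 1 + z.im • L Complex.I := by
  rw [← map_smul, ← map_smul, ← map_add]
  congr 1
  apply Complex.ext <;> simp

/-- In logarithmic polar coordinates the Laplacian is multiplied by `|z|²`. -/
theorem laplacian_polar {E : Type*} [NormedAddCommGroup E] [NormedSpace ℝ E] {f : ℂ → E}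
    (hf : ContDiff ℝ 2 f) (z : ℂ) :
    (fderiv ℝ (fderiv ℝ f) z z z + fderiv ℝ f z z) +
      (fderiv ℝ (fderiv ℝ f) z (Complex.I * z) (Complex.I * z) +
        fderiv ℝ f z (Complex.I * (Complex.I * z))) =
      (z.re ^ 2 + z.im ^ 2) • (Δ f) z := by
  have hsymm : fderiv ℝ (fderiv ℝ f) z 1 Complex.I = fderiv ℝ (fderiv ℝ f) z Complex.I 1 :=
    (hf.contDiffAt.isSymmSndFDerivAt (by simp)).eq 1 Complex.I
  have hI : Complex.I * (Complex.I * z) = -z := by rw [← mul_assoc, Complex.I_mul_I]; ring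
  have h := congrFun (InnerProductSpace.laplacian_eq_iteratedFDeriv_complexPlane f) z
  rw [h, hI, map_neg]
  simp only [iteratedFDeriv_two_apply, Matrix.cons_val_zero, Matrix.cons_val_one]
  rw [clm_apply_re_im (fderiv ℝ (fderiv ℝ f) z) z,
    clm_apply_re_im (fderiv ℝ (fderiv ℝ f) z) (Complex.I * z)]
  simp only [add_apply, smul_apply]
  rw [clm_apply_re_im (fderiv ℝ (fderiv ℝ f) z 1) z,
    clm_apply_re_im (fderiv ℝ (fderiv ℝ f) z 1) (Complex.I * z),
    clm_apply_re_im (fderiv ℝ (fderiv ℝ f) z Complex.I) z,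
    clm_apply_re_im (fderiv ℝ (fderiv ℝ f) z Complex.I) (Complex.I * z), hsymm]
  simp only [Complex.mul_re, Complex.mul_im, Complex.I_re, Complex.I_im]
  module

/-- The pair (z, iz) is the pair (1, i) transformed by a matrix of determinant |z|², and the
expression is alternating in the two directions. It is kept polarized in f and g: g = f gives the
nonlinear term of the `H`-system twice, and f = W, g = φ gives its linearization. -/
theorem cross_polar {f g : ℂ → Fin 3 → ℝ} (z : ℂ) :
    fderiv ℝ f z z ⨯₃ fderiv ℝ g z (Complex.I * z) +
      fderiv ℝ g z z ⨯₃ fderiv ℝ f z (Complex.I * z) =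
      (z.re ^ 2 + z.im ^ 2) • (dx₁ f z ⨯₃ dx₂ g z + dx₁ g z ⨯₃ dx₂ f z) := by
  rw [clm_apply_re_im (fderiv ℝ f z) z, clm_apply_re_im (fderiv ℝ f z) (Complex.I * z),
    clm_apply_re_im (fderiv ℝ g z) z, clm_apply_re_im (fderiv ℝ g z) (Complex.I * z)]
  simp only [dx₁, dx₂, cross_apply, Complex.mul_re, Complex.mul_im, Complex.I_re, Complex.I_im]
  ext i
  fin_cases i <;> simp <;> ring

/-! ### Jets of hyperbolic and trigonometric functions -/

/-- The hyperbolic secant `1 / cosh (μ s)`. -/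
def sech (μ s : ℝ) : ℝ := (Real.cosh (μ * s))⁻¹

/-- The hyperbolic tangent `tanh (μ s)`. -/
def th (μ s : ℝ) : ℝ := Real.sinh (μ * s) * (Real.cosh (μ * s))⁻¹

theorem sech_pos (μ s : ℝ) : 0 < sech μ s := inv_pos.2 (Real.cosh_pos _)

theorem sech_le_one (μ s : ℝ) : sech μ s ≤ 1 := inv_le_one_of_one_le₀ (Real.one_le_cosh _)

theorem sech_sq_add_th_sq (μ s : ℝ) : sech μ s ^ 2 + th μ s ^ 2 = 1 := by
  have h := (Real.cosh_pos (μ * s)).ne'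
  unfold sech th
  field_simp
  linarith [Real.cosh_sq (μ * s)]

theorem abs_th_le_one (μ s : ℝ) : |th μ s| ≤ 1 :=
  (sq_le_one_iff_abs_le_one _).1 (by nlinarith [sech_sq_add_th_sq μ s, sq_nonneg (sech μ s)])

theorem sech_neg (μ s : ℝ) : sech (-μ) s = sech μ s := by simp [sech]

theorem th_neg (μ s : ℝ) : th (-μ) s = -th μ s := by simp [th]

theorem sech_eq_exp (μ s : ℝ) :
    sech μ s = 2 * Real.exp (μ * s) / (Real.exp (μ * s) ^ 2 + 1) := by
  have h := Real.exp_pos (μ * s)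
  rw [sech, Real.cosh_eq, Real.exp_neg]
  field_simp

theorem th_eq_exp (μ s : ℝ) :
    th μ s = (Real.exp (μ * s) ^ 2 - 1) / (Real.exp (μ * s) ^ 2 + 1) := by
  have h := Real.exp_pos (μ * s)
  rw [th, Real.cosh_eq, Real.sinh_eq, Real.exp_neg]
  field_simp

theorem hasDerivAt_sech (μ s : ℝ) : HasDerivAt (sech μ) (-μ * th μ s * sech μ s) s := by
  have h := (Real.cosh_pos (μ * s)).ne'
  have h1 : HasDerivAt (fun s => μ * s) μ s := by simpa using (hasDerivAt_id s).const_mul μ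
  refine ((h1.cosh).inv h).congr_deriv ?_
  unfold sech th
  field_simp

theorem hasDerivAt_th (μ s : ℝ) : HasDerivAt (th μ) (μ * sech μ s ^ 2) s := by
  have h := (Real.cosh_pos (μ * s)).ne'
  have h1 : HasDerivAt (fun s => μ * s) μ s := by simpa using (hasDerivAt_id s).const_mul μ
  refine ((h1.sinh).mul ((h1.cosh).inv h)).congr_deriv ?_
  unfold sech
  simp only [Pi.inv_apply]
  field_simp
  linear_combination μ * Real.cosh_sq (μ * s)

theorem continuous_sech (μ : ℝ) : Continuous (sech μ) :=
  continuous_iff_continuousAt.2 fun s => (hasDerivAt_sech μ s).continuousAt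

theorem continuous_th (μ : ℝ) : Continuous (th μ) :=
  continuous_iff_continuousAt.2 fun s => (hasDerivAt_th μ s).continuousAt

theorem isJet_sech (μ : ℝ) : IsJet (fun s _ => sech μ s) (fun s _ => -μ * th μ s * sech μ s)
    (fun _ _ => 0) (fun s _ => μ ^ 2 * (th μ s ^ 2 - sech μ s ^ 2) * sech μ s)
    (fun _ _ => 0) := by
  refine IsJet.of_left (hasDerivAt_sech μ) (fun s => ?_) ?_
  · refine (((hasDerivAt_th μ s).const_mul (-μ)).mul (hasDerivAt_sech μ s)).congr_deriv ?_
    ring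
  · have := continuous_sech μ
    have := continuous_th μ
    fun_prop

theorem isJet_th (μ : ℝ) : IsJet (fun s _ => th μ s) (fun s _ => μ * sech μ s ^ 2)
    (fun _ _ => 0) (fun s _ => -2 * μ ^ 2 * th μ s * sech μ s ^ 2) (fun _ _ => 0) := by
  refine IsJet.of_left (hasDerivAt_th μ) (fun s => ?_) ?_
  · refine (((hasDerivAt_sech μ s).pow 2).const_mul μ).congr_deriv ?_
    push_cast
    ring
  · have := continuous_sech μ
    have := continuous_th μ
    fun_prop

theorem isJet_cos (μ : ℝ) : IsJet (fun _ t => Real.cos (μ * t)) (fun _ _ => 0)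
    (fun _ t => -μ * Real.sin (μ * t)) (fun _ _ => 0) (fun _ t => -μ ^ 2 * Real.cos (μ * t)) := by
  have h1 : ∀ s, HasDerivAt (fun s => μ * s) μ s := fun s => by
    simpa using (hasDerivAt_id s).const_mul μ
  refine IsJet.of_right (fun s => (h1 s).cos.congr_deriv (by ring)) (fun s =>
    ((h1 s).sin.const_mul (-μ)).congr_deriv (by ring)) (by fun_prop)

theorem isJet_sin (μ : ℝ) : IsJet (fun _ t => Real.sin (μ * t)) (fun _ _ => 0)
    (fun _ t => μ * Real.cos (μ * t)) (fun _ _ => 0) (fun _ t => -μ ^ 2 * Real.sin (μ * t)) := by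
  have h1 : ∀ s, HasDerivAt (fun s => μ * s) μ s := fun s => by
    simpa using (hasDerivAt_id s).const_mul μ
  refine IsJet.of_right (fun s => (h1 s).sin.congr_deriv (by ring)) (fun s =>
    ((h1 s).cos.const_mul μ).congr_deriv (by ring)) (by fun_prop)

/-! ### The bubble in logarithmic polar coordinates -/

theorem polarPt_pow (s t : ℝ) (n : ℕ) :
    polarPt (Real.exp s) t ^ n = polarPt (Real.exp (n * s)) (n * t) := by
  simp only [polarPt, Complex.ofReal_exp, ← Complex.exp_add, ← Complex.exp_nat_mul]
  congr 1
  push_cast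
  ring

theorem conj_polarPt (r t : ℝ) : starRingEnd ℂ (polarPt r t) = polarPt r (-t) := by
  simp [polarPt, ← Complex.exp_conj]

theorem polarPt_re (r t : ℝ) : (polarPt r t).re = r * Real.cos t := by
  simp [polarPt, Complex.exp_ofReal_mul_I_re]

theorem polarPt_im (r t : ℝ) : (polarPt r t).im = r * Real.sin t := by
  simp [polarPt, Complex.exp_ofReal_mul_I_im]

theorem norm_polarPt_exp (s t : ℝ) : ‖polarPt (Real.exp s) t‖ = Real.exp s := by
  rw [polarPt, norm_mul, Complex.norm_exp_ofReal_mul_I, Complex.norm_real, Real.norm_eq_abs,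
    abs_of_pos (Real.exp_pos s), mul_one]

theorem stereoInv_polarPt (s t : ℝ) :
    stereoInv (polarPt (Real.exp s) t) =
      ![sech 1 s * Real.cos t, sech 1 s * Real.sin t, th 1 s] := by
  have h : 0 < 1 + Real.exp s ^ 2 := by positivity
  rw [stereoInv, norm_polarPt_exp, polarPt_re, polarPt_im, sech_eq_exp, th_eq_exp, one_mul]
  ext i
  fin_cases i <;> simp <;> field_simp <;> ring

theorem stereoInv'_polarPt (s t : ℝ) :
    stereoInv' (polarPt (Real.exp s) t) =
      ![sech 1 s * Real.cos t, sech 1 s * Real.sin t, -th 1 s] := by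
  have h : 0 < 1 + Real.exp s ^ 2 := by positivity
  rw [stereoInv', norm_polarPt_exp, polarPt_re, polarPt_im, sech_eq_exp, th_eq_exp, one_mul]
  ext i
  fin_cases i <;> simp <;> field_simp <;> ring

theorem sech_mul (μ s : ℝ) : sech 1 (μ * s) = sech μ s := by simp [sech]

theorem th_mul (μ s : ℝ) : th 1 (μ * s) = th μ s := by simp [th]

/-- A power of z scales both s and t. For m < 0 the conjugation changes the sign of t and
`stereoInv'` that of the last coordinate; since sine and tanh are odd and cosine and sech even, one
formula in the signed m covers both cases. -/
theorem bubble_polarPt {m : ℤ} (hm : m ≠ 0) (s t : ℝ) :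
    bubble m (polarPt (Real.exp s) t) =
      ![sech m s * Real.cos (m * t), sech m s * Real.sin (m * t), th m s] := by
  unfold bubble
  split_ifs with h
  · have : ((m.natAbs : ℕ) : ℝ) = (m : ℝ) := by
      rw [Nat.cast_natAbs, abs_of_pos h]
    rw [polarPt_pow, stereoInv_polarPt, sech_mul, th_mul, this]
  · have : ((m.natAbs : ℕ) : ℝ) = -(m : ℝ) := by
      rw [Nat.cast_natAbs, abs_of_neg (lt_of_le_of_ne (not_lt.1 h) hm)]
      push_cast
      rfl
    rw [conj_polarPt, polarPt_pow, stereoInv'_polarPt, sech_mul, th_mul, this, sech_neg, th_neg]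
    simp

theorem contDiff_norm_sq_complex : ContDiff ℝ 2 fun z : ℂ => ‖z‖ ^ 2 := contDiff_norm_sq ℝ

theorem contDiff_stereoInv : ContDiff ℝ 2 stereoInv := by
  have hn := contDiff_norm_sq_complex
  have hre : ContDiff ℝ 2 fun z : ℂ => z.re := Complex.reCLM.contDiff
  have him : ContDiff ℝ 2 fun z : ℂ => z.im := Complex.imCLM.contDiff
  unfold stereoInv
  refine ContDiff.smul (contDiff_const.div (contDiff_const.add hn) fun z => by positivity) ?_
  refine contDiff_pi.2 fun i => ?_
  fin_cases i
  · exact contDiff_const.mul hre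
  · exact contDiff_const.mul him
  · exact hn.sub contDiff_const

theorem contDiff_stereoInv' : ContDiff ℝ 2 stereoInv' := by
  have hn := contDiff_norm_sq_complex
  have hre : ContDiff ℝ 2 fun z : ℂ => z.re := Complex.reCLM.contDiff
  have him : ContDiff ℝ 2 fun z : ℂ => z.im := Complex.imCLM.contDiff
  unfold stereoInv'
  refine ContDiff.smul (contDiff_const.div (contDiff_const.add hn) fun z => by positivity) ?_
  refine contDiff_pi.2 fun i => ?_
  fin_cases i
  · exact contDiff_const.mul hre
  · exact contDiff_const.mul him
  · exact contDiff_const.sub hn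

theorem contDiff_bubble (m : ℤ) : ContDiff ℝ 2 (bubble m) := by
  unfold bubble
  split_ifs
  · exact contDiff_stereoInv.comp (contDiff_id.pow _)
  · exact contDiff_stereoInv'.comp (Complex.conjCLE.contDiff.pow _)

/-- The bubble in logarithmic polar coordinates. -/
def bub (m : ℤ) (s t : ℝ) : Fin 3 → ℝ :=
  ![sech m s * Real.cos (m * t), sech m s * Real.sin (m * t), th m s]

/-- The derivative of the bubble in `s = log r`. -/
def bubS (m : ℤ) (s t : ℝ) : Fin 3 → ℝ :=
  ![-m * th m s * sech m s * Real.cos (m * t), -m * th m s * sech m s * Real.sin (m * t),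
    m * sech m s ^ 2]

/-- The derivative of the bubble in `θ`. -/
def bubT (m : ℤ) (s t : ℝ) : Fin 3 → ℝ :=
  ![-m * sech m s * Real.sin (m * t), m * sech m s * Real.cos (m * t), 0]

/-- The jet of the bubble in logarithmic polar coordinates. -/
theorem bubble_jet {m : ℤ} (hm : m ≠ 0) (s t : ℝ) :
    fderiv ℝ (bubble m) (polarPt (Real.exp s) t) (polarPt (Real.exp s) t) = bubS m s t ∧
    fderiv ℝ (bubble m) (polarPt (Real.exp s) t) (Complex.I * polarPt (Real.exp s) t) =
      bubT m s t ∧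
    ((polarPt (Real.exp s) t).re ^ 2 + (polarPt (Real.exp s) t).im ^ 2) •
      (Δ (bubble m)) (polarPt (Real.exp s) t) = (-2 * m ^ 2 * sech m s ^ 2) • bub m s t := by
  have hJ := isJet_polar (contDiff_bubble m)
  have hlap := laplacian_polar (contDiff_bubble m) (polarPt (Real.exp s) t)
  have h0 := hJ.clm (ContinuousLinearMap.proj 0 : (Fin 3 → ℝ) →L[ℝ] ℝ)
  have h1 := hJ.clm (ContinuousLinearMap.proj 1 : (Fin 3 → ℝ) →L[ℝ] ℝ)
  have h2 := hJ.clm (ContinuousLinearMap.proj 2 : (Fin 3 → ℝ) →L[ℝ] ℝ)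
  simp only [bubble_polarPt hm, ContinuousLinearMap.proj_apply, Matrix.cons_val] at h0 h1 h2
  -- The jet given by `fderiv` and the jet of the explicit formula belong to the same function, so
  -- their entries agree.
  obtain ⟨a0, b0, c0, d0⟩ := h0.unique ((isJet_sech m).mul (isJet_cos m))
  obtain ⟨a1, b1, c1, d1⟩ := h1.unique ((isJet_sech m).mul (isJet_sin m))
  obtain ⟨a2, b2, c2, d2⟩ := h2.unique (isJet_th m)
  have hst := sech_sq_add_th_sq m s
  refine ⟨?_, ?_, ?_⟩
  · ext i
    fin_cases i
    · simpa [bubS] using congrFun₂ a0 s t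
    · simpa [bubS] using congrFun₂ a1 s t
    · simpa [bubS] using congrFun₂ a2 s t
  · ext i
    fin_cases i
    · have := congrFun₂ b0 s t
      simp only [bubT, Fin.zero_eta, Matrix.cons_val_zero]
      linear_combination this
    · have := congrFun₂ b1 s t
      simp only [bubT, Fin.mk_one, Matrix.cons_val_one, Matrix.cons_val_zero]
      linear_combination this
    · simpa [bubT] using congrFun₂ b2 s t
  · rw [← hlap]
    ext i
    fin_cases i
    · have e := congrFun₂ c0 s t
      have e' := congrFun₂ d0 s t
      simp only [Fin.zero_eta, Pi.add_apply, Pi.smul_apply, bub, Matrix.cons_val, smul_eq_mul]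
        at e e' ⊢
      linear_combination e + e' + m ^ 2 * sech m s * Real.cos (m * t) * hst
    · have e := congrFun₂ c1 s t
      have e' := congrFun₂ d1 s t
      simp only [Fin.mk_one, Pi.add_apply, Pi.smul_apply, bub, Matrix.cons_val, smul_eq_mul]
        at e e' ⊢
      linear_combination e + e' + m ^ 2 * sech m s * Real.sin (m * t) * hst
    · have e := congrFun₂ c2 s t
      have e' := congrFun₂ d2 s t
      simp only [Fin.reduceFinMk, Pi.add_apply, Pi.smul_apply, bub, Matrix.cons_val, smul_eq_mul]
        at e e' ⊢
      linear_combination e + e'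

theorem exists_polarPt_exp {z : ℂ} (hz : z ≠ 0) : ∃ s t : ℝ, z = polarPt (Real.exp s) t := by
  refine ⟨Real.log ‖z‖, z.arg, ?_⟩
  rw [Real.exp_log (norm_pos_iff.2 hz), polarPt, Complex.norm_mul_exp_arg_mul_I]

theorem re_sq_add_im_sq_polarPt (s t : ℝ) :
    (polarPt (Real.exp s) t).re ^ 2 + (polarPt (Real.exp s) t).im ^ 2 = Real.exp s ^ 2 := by
  rw [polarPt_re, polarPt_im]
  linear_combination Real.exp s ^ 2 * Real.sin_sq_add_cos_sq t

theorem bubble_equation_of_ne_zero {m : ℤ} (hm : m ≠ 0) {z : ℂ} (hz : z ≠ 0) :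
    (Δ (bubble m)) z = (2 : ℝ) • (dx₁ (bubble m) z ⨯₃ dx₂ (bubble m) z) := by
  obtain ⟨s, t, rfl⟩ := exists_polarPt_exp hz
  obtain ⟨h1, h2, h3⟩ := bubble_jet hm s t
  have hc := cross_polar (f := bubble m) (g := bubble m) (polarPt (Real.exp s) t)
  rw [h1, h2] at hc
  rw [re_sq_add_im_sq_polarPt] at hc h3
  have hne : Real.exp s ^ 2 ≠ 0 := by positivity
  refine smul_right_injective _ hne ?_
  simp only
  rw [h3, two_smul, ← hc]
  have hcs := Real.sin_sq_add_cos_sq (m * t)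
  ext i
  fin_cases i
  · simp [bub, bubS, bubT, cross_apply]
    ring
  · simp [bub, bubS, bubT, cross_apply]
    ring
  · simp [bub, bubS, bubT, cross_apply]
    linear_combination (2 * m ^ 2 * th m s * sech m s ^ 2) * hcs

theorem bubble_solves {m : ℤ} (hm : m ≠ 0) : SolvesHSystem (bubble m) := by
  have hf := contDiff_bubble m
  refine ⟨hf, fun z => ?_⟩
  have hf1 : ContDiff ℝ 1 (fderiv ℝ (bubble m)) := hf.fderiv_right (by norm_num)
  have hf2 : Continuous (fderiv ℝ (fderiv ℝ (bubble m))) := hf1.continuous_fderiv (by norm_num)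
  have cl : Continuous (Δ (bubble m)) := by
    rw [InnerProductSpace.laplacian_eq_iteratedFDeriv_complexPlane]
    simp only [iteratedFDeriv_two_apply, Matrix.cons_val_zero, Matrix.cons_val_one]
    fun_prop
  have c1 : Continuous (dx₁ (bubble m)) := hf1.continuous.clm_apply continuous_const
  have c2 : Continuous (dx₂ (bubble m)) := hf1.continuous.clm_apply continuous_const
  have cr : Continuous fun z => dx₁ (bubble m) z ⨯₃ dx₂ (bubble m) z := by
    have c1' : ∀ i, Continuous fun z => dx₁ (bubble m) z i := fun i => (continuous_apply i).comp c1
    have c2' : ∀ i, Continuous fun z => dx₂ (bubble m) z i := fun i => (continuous_apply i).comp c2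
    simp only [cross_apply]
    refine continuous_pi fun i => ?_
    fin_cases i
    · exact ((c1' 1).mul (c2' 2)).sub ((c1' 2).mul (c2' 1))
    · exact ((c1' 2).mul (c2' 0)).sub ((c1' 0).mul (c2' 2))
    · exact ((c1' 0).mul (c2' 1)).sub ((c1' 1).mul (c2' 0))
  -- Polar coordinates miss the origin; there the equation follows by continuity of both sides.
  have := Continuous.ext_on (dense_compl_singleton (0 : ℂ)) cl (cr.const_smul (2 : ℝ))
    fun w hw => bubble_equation_of_ne_zero hm hw
  exact congrFun this z

theorem exp_zpow (m : ℤ) (s : ℝ) : Real.exp s ^ m = Real.exp (m * s) :=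
  by rw [← Real.rpow_intCast, ← Real.exp_mul, mul_comm]

theorem exp_zpow_two_mul (m : ℤ) (s : ℝ) : Real.exp s ^ (2 * m) = Real.exp (m * s) ^ 2 := by
  rw [exp_zpow, ← Real.exp_nat_mul]
  congr 1
  push_cast
  ring

theorem bubble_polar {m : ℤ} (hm : m ≠ 0) {r : ℝ} (hr : 0 < r) (θ : ℝ) :
    bubble m (polarPt r θ) =
      ![2 * r ^ m * Real.cos (m * θ) / (r ^ (2 * m) + 1),
        2 * r ^ m * Real.sin (m * θ) / (r ^ (2 * m) + 1),
        (r ^ (2 * m) - 1) / (r ^ (2 * m) + 1)] := by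
  obtain ⟨s, rfl⟩ : ∃ s, r = Real.exp s := ⟨Real.log r, (Real.exp_log hr).symm⟩
  rw [bubble_polarPt hm, exp_zpow_two_mul, exp_zpow, sech_eq_exp, th_eq_exp]
  ext i
  fin_cases i <;> simp <;> ring

/-! ### The linearized equation projected on the moving frame -/

/-- The linearized equation in logarithmic polar coordinates. -/
theorem linearized_polar {m : ℤ} (hm : m ≠ 0) {φ : ℂ → Fin 3 → ℝ}
    (hφ : SolvesLinearized (bubble m) φ) :
    ∃ Fs Ft Fss Ftt, IsJet (fun s t => φ (polarPt (Real.exp s) t)) Fs Ft Fss Ftt ∧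
      ∀ s t, Fss s t + Ftt s t = (2 : ℝ) • (bubS m s t ⨯₃ Ft s t + Fs s t ⨯₃ bubT m s t) := by
  refine ⟨_, _, _, _, isJet_polar hφ.1, fun s t => ?_⟩
  obtain ⟨h1, h2, -⟩ := bubble_jet hm s t
  rw [laplacian_polar hφ.1, hφ.2, smul_comm, ← cross_polar, h1, h2]

section Projections

variable {m : ℤ} {F Fs Ft Fss Ftt : ℝ → ℝ → Fin 3 → ℝ}

/-- The first frame vector in logarithmic polar coordinates. -/
def fr₁ (m : ℤ) (s t : ℝ) : Fin 3 → ℝ :=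
  ![th m s * Real.cos (m * t), th m s * Real.sin (m * t), -sech m s]

/-- The second frame vector in logarithmic polar coordinates. -/
def fr₂ (m : ℤ) (_s t : ℝ) : Fin 3 → ℝ :=
  ![-Real.sin (m * t), Real.cos (m * t), 0]

/-- The equation for the component along the bubble. -/
theorem normal_equation (hJ : IsJet F Fs Ft Fss Ftt)
    (heq : ∀ s t, Fss s t + Ftt s t =
      (2 : ℝ) • (bubS m s t ⨯₃ Ft s t + Fs s t ⨯₃ bubT m s t)) :
    ∃ us ut uss utt, IsJet (fun s t => F s t 0 * bub m s t 0 + F s t 1 * bub m s t 1 +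
      F s t 2 * bub m s t 2) us ut uss utt ∧
      ∀ s t, uss s t + utt s t = -2 * m ^ 2 * sech m s ^ 2 *
        (F s t 0 * bub m s t 0 + F s t 1 * bub m s t 1 + F s t 2 * bub m s t 2) := by
  have h0 := hJ.clm (ContinuousLinearMap.proj 0 : (Fin 3 → ℝ) →L[ℝ] ℝ)
  have h1 := hJ.clm (ContinuousLinearMap.proj 1 : (Fin 3 → ℝ) →L[ℝ] ℝ)
  have h2 := hJ.clm (ContinuousLinearMap.proj 2 : (Fin 3 → ℝ) →L[ℝ] ℝ)
  refine ⟨_, _, _, _, ((h0.mul ((isJet_sech m).mul (isJet_cos m))).add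
    (h1.mul ((isJet_sech m).mul (isJet_sin m)))).add (h2.mul (isJet_th m)), fun s t => ?_⟩
  have e0 := congrFun (heq s t) 0
  have e1 := congrFun (heq s t) 1
  have e2 := congrFun (heq s t) 2
  have hst := sech_sq_add_th_sq m s
  have hcs := Real.sin_sq_add_cos_sq (m * t)
  simp [cross_apply, bubS, bubT, bub] at e0 e1 e2 ⊢
  -- What is left is polynomial algebra: the three components of the equation together with sech² +
  -- tanh² = 1 and sin² + cos² = 1.
  generalize sech m s = S at *
  generalize th m s = T at *
  generalize Real.cos (m * t) = c at *
  generalize Real.sin (m * t) = d at *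
  generalize (m : ℝ) = μ at *
  generalize F s t = A, Fs s t = B, Ft s t = C, Fss s t = X, Ftt s t = Y at *
  grind

/-- The equations for the components along the frame. -/
theorem tangential_equation (hJ : IsJet F Fs Ft Fss Ftt)
    (heq : ∀ s t, Fss s t + Ftt s t =
      (2 : ℝ) • (bubS m s t ⨯₃ Ft s t + Fs s t ⨯₃ bubT m s t)) :
    ∃ ps pt pss ptt qs qt qss qtt,
      IsJet (fun s t => F s t 0 * fr₁ m s t 0 + F s t 1 * fr₁ m s t 1 +
        F s t 2 * fr₁ m s t 2) ps pt pss ptt ∧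
      IsJet (fun s t => F s t 0 * fr₂ m s t 0 + F s t 1 * fr₂ m s t 1) qs qt qss qtt ∧
      (∀ s t, pss s t + ptt s t = m ^ 2 * (th m s ^ 2 - sech m s ^ 2) *
        (F s t 0 * fr₁ m s t 0 + F s t 1 * fr₁ m s t 1 + F s t 2 * fr₁ m s t 2) +
          2 * m * th m s * qt s t) ∧
      ∀ s t, qss s t + qtt s t = m ^ 2 * (th m s ^ 2 - sech m s ^ 2) *
        (F s t 0 * fr₂ m s t 0 + F s t 1 * fr₂ m s t 1) - 2 * m * th m s * pt s t := by
  have h0 := hJ.clm (ContinuousLinearMap.proj 0 : (Fin 3 → ℝ) →L[ℝ] ℝ)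
  have h1 := hJ.clm (ContinuousLinearMap.proj 1 : (Fin 3 → ℝ) →L[ℝ] ℝ)
  have h2 := hJ.clm (ContinuousLinearMap.proj 2 : (Fin 3 → ℝ) →L[ℝ] ℝ)
  refine ⟨_, _, _, _, _, _, _, _, ((h0.mul ((isJet_th m).mul (isJet_cos m))).add
    (h1.mul ((isJet_th m).mul (isJet_sin m)))).add
      (h2.mul ((isJet_sech m).clm (-ContinuousLinearMap.id ℝ ℝ))),
    (h0.mul ((isJet_sin m).clm (-ContinuousLinearMap.id ℝ ℝ))).add (h1.mul (isJet_cos m)),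
    fun s t => ?_, fun s t => ?_⟩
  all_goals
    have e0 := congrFun (heq s t) 0
    have e1 := congrFun (heq s t) 1
    have e2 := congrFun (heq s t) 2
    have hst := sech_sq_add_th_sq m s
    have hcs := Real.sin_sq_add_cos_sq (m * t)
    simp [cross_apply, bubS, bubT, fr₁, fr₂] at e0 e1 e2 ⊢
    generalize sech m s = S at *
    generalize th m s = T at *
    generalize Real.cos (m * t) = c at *
    generalize Real.sin (m * t) = d at *
    generalize (m : ℝ) = μ at *
    generalize F s t = A, Fs s t = B, Ft s t = C, Fss s t = X, Ftt s t = Y at *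
    grind

end Projections

/-! ### Fourier modes in the angle -/

section Modes

open MeasureTheory

/-- The `k`-th Fourier mode in `t` of a function of `s` and `t`. -/
def mode (u : ℝ → ℝ → ℂ) (k : ℤ) (s : ℝ) : ℂ :=
  ∫ t in (0 : ℝ)..(2 * Real.pi), Complex.exp (-(k * t) * Complex.I) * u s t

theorem continuous_character (k : ℤ) :
    Continuous fun t : ℝ => Complex.exp (-(k * t) * Complex.I) := by fun_prop

theorem norm_character (k : ℤ) (t : ℝ) : ‖Complex.exp (-(k * t) * Complex.I)‖ = 1 := by
  have : (-(k * t) * Complex.I : ℂ) = ((-(k * t) : ℝ) : ℂ) * Complex.I := by push_cast; ring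
  rw [this, Complex.norm_exp_ofReal_mul_I]

theorem continuous_slice {u : ℝ → ℝ → ℂ} (hu : Continuous fun p : ℝ × ℝ => u p.1 p.2) (s : ℝ) :
    Continuous (u s) := hu.comp (by fun_prop : Continuous fun t : ℝ => (s, t))

theorem continuous_mode_integrand {u : ℝ → ℝ → ℂ} (hu : Continuous fun p : ℝ × ℝ => u p.1 p.2)
    (k : ℤ) (s : ℝ) : Continuous fun t : ℝ => Complex.exp (-(k * t) * Complex.I) * u s t :=
  (continuous_character k).mul (continuous_slice hu s)

theorem hasDerivAt_mode {u us : ℝ → ℝ → ℂ} (hd : ∀ s t, HasDerivAt (fun s => u s t) (us s t) s)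
    (hu : Continuous fun p : ℝ × ℝ => u p.1 p.2) (hus : Continuous fun p : ℝ × ℝ => us p.1 p.2)
    (k : ℤ) (s : ℝ) : HasDerivAt (mode u k) (mode us k s) s := by
  -- Continuity of `us` on a compact rectangle provides the constant dominating function for
  -- differentiation under the integral.
  obtain ⟨C, hC⟩ := ((isCompact_Icc (a := s - 1) (b := s + 1)).prod
    (isCompact_Icc (a := (0 : ℝ)) (b := 2 * Real.pi))).exists_bound_of_continuousOn
    hus.continuousOn
  have h2π : (0 : ℝ) ≤ 2 * Real.pi := by positivity
  refine (intervalIntegral.hasDerivAt_integral_of_dominated_loc_of_deriv_le (bound := fun _ => C)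
    (F' := fun s t => Complex.exp (-(k * t) * Complex.I) * us s t)
    (Icc_mem_nhds (show s - 1 < s by linarith) (show s < s + 1 by linarith))
    (Filter.Eventually.of_forall fun x => (continuous_mode_integrand hu k x).aestronglyMeasurable)
    ((continuous_mode_integrand hu k s).intervalIntegrable _ _)
    (continuous_mode_integrand hus k s).aestronglyMeasurable
    (ae_of_all _ fun t ht x hx => ?_) intervalIntegrable_const
    (ae_of_all _ fun t _ x _ => (hd x t).const_mul _)).2
  rw [norm_mul, norm_character, one_mul]
  rw [Set.uIoc_of_le h2π] at ht
  exact hC (x, t) ⟨hx, ht.1.le, ht.2⟩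

/-- Integration by parts for Fourier modes. -/
theorem mode_deriv_t {u ut : ℝ → ℝ → ℂ} (hd : ∀ s t, HasDerivAt (fun t => u s t) (ut s t) t)
    (hu : Continuous fun p : ℝ × ℝ => u p.1 p.2) (hut : Continuous fun p : ℝ × ℝ => ut p.1 p.2)
    (hper : ∀ s, u s (2 * Real.pi) = u s 0) (k : ℤ) (s : ℝ) :
    mode ut k s = k * Complex.I * mode u k s := by
  have he : ∀ t : ℝ, HasDerivAt (fun t : ℝ => Complex.exp (-(k * t) * Complex.I))
      (-(k * Complex.I) * Complex.exp (-(k * t) * Complex.I)) t := fun t => by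
    have h1 : HasDerivAt (fun t : ℝ => (-(k * t) * Complex.I : ℂ)) (-(k * 1) * Complex.I) t :=
      (((Complex.ofRealCLM.hasDerivAt (x := t)).const_mul (k : ℂ)).neg).mul_const _
    refine h1.cexp.congr_deriv ?_
    ring
  have c1 : Continuous fun t : ℝ =>
      -(k * Complex.I) * Complex.exp (-(k * t) * Complex.I) * u s t :=
    ((continuous_character k).const_mul _).mul (continuous_slice hu s)
  have c2 := continuous_mode_integrand hut k s
  have hint := intervalIntegral.integral_eq_sub_of_hasDerivAt
    (a := 0) (b := 2 * Real.pi) (fun t _ => (he t).mul (hd s t))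
    ((c1.add c2).intervalIntegrable _ _)
  rw [intervalIntegral.integral_add (c1.intervalIntegrable _ _)
    (c2.intervalIntegrable _ _)] at hint
  have hexp : Complex.exp (-(k * ((2 * Real.pi : ℝ) : ℂ)) * Complex.I) = 1 := by
    have : (-(k * ((2 * Real.pi : ℝ) : ℂ)) * Complex.I : ℂ) =
        ((-k : ℤ) : ℂ) * (2 * Real.pi * Complex.I) := by push_cast; ring
    rw [this, Complex.exp_int_mul_two_pi_mul_I]
  simp only [Pi.mul_apply, hexp, hper s, mul_assoc, intervalIntegral.integral_const_mul] at hint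
  simp only [Complex.ofReal_zero, mul_zero, neg_zero, zero_mul, Complex.exp_zero, sub_self] at hint
  unfold mode
  linear_combination hint

theorem norm_mode_le {u : ℝ → ℝ → ℂ} {C : ℝ} (h : ∀ s t, ‖u s t‖ ≤ C) (k : ℤ) (s : ℝ) :
    ‖mode u k s‖ ≤ C * (2 * Real.pi) := by
  have := intervalIntegral.norm_integral_le_of_norm_le_const (a := 0) (b := 2 * Real.pi)
    (f := fun t : ℝ => Complex.exp (-(k * t) * Complex.I) * u s t) (C := C) fun t _ => by
      rw [norm_mul, norm_character, one_mul]
      exact h s t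
  rwa [sub_zero, abs_of_nonneg (by positivity)] at this

theorem hasDerivAt_periodic {f f' : ℝ → ℂ} (hd : ∀ t, HasDerivAt f (f' t) t)
    (hper : Function.Periodic f (2 * Real.pi)) : Function.Periodic f' (2 * Real.pi) := fun t => by
  have h := (hd (t + 2 * Real.pi)).comp_add_const t (2 * Real.pi)
  simp only [hper _] at h
  exact h.unique (hd t)

/-- A continuous periodic function with finitely many Fourier modes is a trigonometric
polynomial. -/
theorem eq_sum_modes {f : ℝ → ℂ} (hf : Continuous f) (hper : Function.Periodic f (2 * Real.pi))
    (K : Finset ℤ)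
    (hK : ∀ k ∉ K, ∫ t in (0 : ℝ)..(2 * Real.pi), Complex.exp (-(k * t) * Complex.I) * f t = 0)
    (t : ℝ) :
    f t = ∑ k ∈ K, (1 / (2 * Real.pi) : ℂ) *
      (∫ t in (0 : ℝ)..(2 * Real.pi), Complex.exp (-(k * t) * Complex.I) * f t) *
      Complex.exp (k * t * Complex.I) := by
  have : Fact (0 < 2 * Real.pi) := ⟨by positivity⟩
  let g : C(AddCircle (2 * Real.pi), ℂ) := ⟨hper.lift, continuous_coinduced_dom.mpr hf⟩
  have hg : ∀ x : ℝ, g (x : AddCircle (2 * Real.pi)) = f x := fun x => hper.lift_coe x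
  have hco : ∀ k, fourierCoeff g k = (1 / (2 * Real.pi) : ℂ) *
      ∫ t in (0 : ℝ)..(2 * Real.pi), Complex.exp (-(k * t) * Complex.I) * f t := fun k => by
    rw [fourierCoeff_eq_intervalIntegral g k 0, zero_add, Complex.real_smul]
    congr 1
    · push_cast
      rfl
    · refine intervalIntegral.integral_congr fun x _ => ?_
      simp only [hg, fourier_coe_apply, smul_eq_mul]
      congr 2
      have : (Real.pi : ℂ) ≠ 0 := by exact_mod_cast Real.pi_ne_zero
      push_cast
      field_simp
  have hz : ∀ k ∉ K, fourierCoeff g k = 0 := fun k hk => by rw [hco, hK k hk, mul_zero]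
  -- Finitely supported coefficients are summable, so the Fourier series converges pointwise to the
  -- continuous function; uniqueness of sums identifies it with the finite sum.
  have h1 := has_pointwise_sum_fourier_series_of_summable
    (summable_of_ne_finset_zero (s := K) hz) (t : AddCircle (2 * Real.pi))
  have h2 : HasSum (fun k => fourierCoeff g k • fourier k (t : AddCircle (2 * Real.pi)))
      (∑ k ∈ K, fourierCoeff g k • fourier k (t : AddCircle (2 * Real.pi))) :=
    hasSum_sum_of_ne_finset_zero fun k hk => by rw [hz k hk, zero_smul]
  rw [← hg, h1.unique h2]
  refine Finset.sum_congr rfl fun k _ => ?_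
  rw [hco, smul_eq_mul, fourier_coe_apply]
  congr 2
  have : (Real.pi : ℂ) ≠ 0 := by exact_mod_cast Real.pi_ne_zero
  push_cast
  field_simp

end Modes

/-! ### Bounded solutions of the mode equations -/

section ODE

theorem eq_of_hasDerivAt_zero {f : ℝ → ℂ} (h : ∀ s, HasDerivAt f 0 s) (s : ℝ) : f s = f 0 :=
  is_const_of_deriv_eq_zero (fun s => (h s).differentiableAt) (fun s => (h s).deriv) s 0

/-- On [s, s + 1] the derivative stays within D of y'(s), so y(s + 1) - y(s) differs from y'(s) by
at most D. This makes the first-order transforms of bounded solutions bounded. -/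
theorem norm_deriv_le_of_bounded {y y' y'' : ℝ → ℂ} (h : ∀ s, HasDerivAt y (y' s) s)
    (h' : ∀ s, HasDerivAt y' (y'' s) s) {C D : ℝ} (hC : ∀ s, ‖y s‖ ≤ C) (hD : ∀ s, ‖y'' s‖ ≤ D)
    (s : ℝ) : ‖y' s‖ ≤ 2 * C + D := by
  have h1 : ∀ x ∈ Set.Icc s (s + 1), ‖y' x - y' s‖ ≤ D := fun x hx => by
    have := (convex_univ (𝕜 := ℝ) (E := ℝ)).norm_image_sub_le_of_norm_hasDerivWithin_le
      (fun x _ => (h' x).hasDerivWithinAt) (fun x _ => hD x) (Set.mem_univ s) (Set.mem_univ x)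
    refine this.trans ?_
    rw [Real.norm_eq_abs, abs_of_nonneg (by linarith [hx.1])]
    nlinarith [hx.2, (norm_nonneg _).trans (hD s)]
  have h2 : ∀ x, HasDerivAt (fun x : ℝ => y x - x * y' s) (y' x - 1 * y' s) x := fun x =>
    (h x).sub ((Complex.ofRealCLM.hasDerivAt (x := x)).mul_const _)
  have h3 := (convex_Icc s (s + 1)).norm_image_sub_le_of_norm_hasDerivWithin_le
    (fun x _ => (h2 x).hasDerivWithinAt) (fun x hx => by simpa using h1 x hx)
    (Set.left_mem_Icc.2 (by linarith)) (Set.right_mem_Icc.2 (by linarith))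
  have h4 : y' s = (y (s + 1) - y s) -
      ((y (s + 1) - ((s + 1 : ℝ) : ℂ) * y' s) - (y s - s * y' s)) := by
    push_cast
    ring
  have h5 : ‖(s + 1) - s‖ = 1 := by simp
  rw [h5, mul_one] at h3
  rw [h4]
  refine (norm_sub_le _ _).trans (add_le_add ((norm_sub_le _ _).trans ?_) h3)
  linarith [hC s, hC (s + 1)]

theorem eq_zero_of_exp_bound {c : ℂ} {a C : ℝ} (ha : 0 < a)
    (h : ∀ s, 0 ≤ s → ‖c‖ * Real.exp (a * s) ≤ C) : c = 0 := by
  by_contra hc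
  have hc' := norm_pos_iff.2 hc
  have hC : 0 ≤ C := le_trans (by positivity) (h 0 le_rfl)
  -- At this s the exponent a s equals C / ‖c‖, and e^x ≥ 1 + x yields the contradiction C + ‖c‖ ≤
  -- C.
  have h1 := h (C / ‖c‖ / a) (by positivity)
  rw [mul_div_cancel₀ _ ha.ne'] at h1
  have h2 := mul_le_mul_of_nonneg_left (Real.add_one_le_exp (C / ‖c‖)) hc'.le
  rw [mul_add, mul_div_cancel₀ _ hc'.ne'] at h2
  linarith

theorem eq_zero_of_exp_bound_line {c : ℂ} {a C : ℝ} (ha : a ≠ 0)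
    (h : ∀ s, ‖c‖ * Real.exp (a * s) ≤ C) : c = 0 := by
  rcases lt_or_gt_of_ne ha with ha | ha
  · refine eq_zero_of_exp_bound (a := -a) (C := C) (by linarith) fun s _ => ?_
    simpa using h (-s)
  · exact eq_zero_of_exp_bound ha fun s _ => h s

theorem eq_zero_of_linear_bound {c d : ℂ} {C : ℝ} (h : ∀ s : ℝ, ‖c * s + d‖ ≤ C) : c = 0 := by
  by_contra hc
  have hc' := norm_pos_iff.2 hc
  have h0 : ‖d‖ ≤ C := by simpa using h 0
  have h1 := h ((2 * C + 1) / ‖c‖)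
  have h2 : ‖c * (((2 * C + 1) / ‖c‖ : ℝ) : ℂ)‖ = |2 * C + 1| := by
    rw [norm_mul, Complex.norm_real, Real.norm_eq_abs, abs_div, abs_norm]
    field_simp
  have h3 := norm_sub_le (c * (((2 * C + 1) / ‖c‖ : ℝ) : ℂ) + d) d
  rw [add_sub_cancel_right, h2] at h3
  linarith [le_abs_self (2 * C + 1)]

theorem hasDerivAt_exp_mul (κ s : ℝ) :
    HasDerivAt (fun s : ℝ => ((Real.exp (κ * s) : ℝ) : ℂ)) (κ * (Real.exp (κ * s) : ℝ)) s := by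
  have h1 : HasDerivAt (fun s => κ * s) κ s := by simpa using (hasDerivAt_id s).const_mul κ
  refine h1.exp.ofReal_comp.congr_deriv ?_
  push_cast
  ring

/-- A bounded solution of `v' = κ v`, `κ ≠ 0`, on the line vanishes. -/
theorem eq_zero_of_first_order {v : ℝ → ℂ} {κ C : ℝ} (hκ : κ ≠ 0)
    (h : ∀ s, HasDerivAt v (κ * v s) s) (hC : ∀ s, ‖v s‖ ≤ C) (s : ℝ) : v s = 0 := by
  have h1 : ∀ s, HasDerivAt (fun s => v s * ((Real.exp (-κ * s) : ℝ) : ℂ)) 0 s := fun s => by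
    refine ((h s).mul (hasDerivAt_exp_mul (-κ) s)).congr_deriv ?_
    push_cast
    ring
  have h2 := eq_of_hasDerivAt_zero h1
  have h3 : ∀ s, v s = v 0 * ((Real.exp (κ * s) : ℝ) : ℂ) := fun s => by
    have := h2 s
    simp only [mul_zero, Real.exp_zero, Complex.ofReal_one, mul_one] at this
    rw [← this, mul_assoc, ← Complex.ofReal_mul, ← Real.exp_add]
    simp
  have h4 : v 0 = 0 := by
    refine eq_zero_of_exp_bound_line (C := C) hκ fun s => ?_
    have := hC s
    rwa [h3, norm_mul, Complex.norm_real, Real.norm_eq_abs, Real.abs_exp] at this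
  rw [h3, h4, zero_mul]

/-- Both z' - κ z and z' + κ z are bounded and solve first-order equations with rates -κ and κ, so
both vanish, and their difference is a nonzero multiple of z. -/
theorem eq_zero_of_second_order {z z' : ℝ → ℂ} {κ C D : ℝ} (hκ : κ ≠ 0)
    (h : ∀ s, HasDerivAt z (z' s) s) (h' : ∀ s, HasDerivAt z' (κ ^ 2 * z s) s)
    (hC : ∀ s, ‖z s‖ ≤ C) (hD : ∀ s, ‖z' s‖ ≤ D) (s : ℝ) : z s = 0 := by
  have key : ∀ κ : ℝ, κ ≠ 0 → (∀ s, HasDerivAt z' (κ ^ 2 * z s) s) → ∀ s, z' s = κ * z s := by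
    intro κ hκ h' s
    have := eq_zero_of_first_order (v := fun s => z' s - κ * z s) (κ := -κ) (C := D + |κ| * C)
      (neg_ne_zero.2 hκ) (fun s => ?_) (fun s => ?_) s
    · exact sub_eq_zero.1 this
    · refine ((h' s).sub ((h s).const_mul _)).congr_deriv ?_
      push_cast
      ring
    · refine (norm_sub_le _ _).trans (add_le_add (hD s) ?_)
      rw [norm_mul, Complex.norm_real, Real.norm_eq_abs]
      exact mul_le_mul_of_nonneg_left (hC s) (abs_nonneg κ)
  have h1 := key κ hκ h' s
  have h2 := key (-κ) (neg_ne_zero.2 hκ) (by simpa using h') s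
  have h3 : (2 * κ : ℂ) * z s = 0 := by
    push_cast at h2
    linear_combination h2 - h1
  have h4 : (2 * κ : ℂ) ≠ 0 := by simpa using hκ
  exact (mul_eq_zero.1 h3).resolve_left h4

variable {y y' : ℝ → ℂ} {μ κ C : ℝ}

theorem hasDerivAt_th_ofReal (μ s : ℝ) :
    HasDerivAt (fun s => (th μ s : ℂ)) (μ * sech μ s ^ 2) s :=
  (hasDerivAt_th μ s).ofReal_comp.congr_deriv (by push_cast; rfl)

theorem hasDerivAt_sech_ofReal (μ s : ℝ) :
    HasDerivAt (fun s => (sech μ s : ℂ)) (-μ * th μ s * sech μ s) s :=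
  (hasDerivAt_sech μ s).ofReal_comp.congr_deriv (by push_cast; rfl)

theorem sech_sq_add_th_sq_ofReal (μ s : ℝ) : (sech μ s : ℂ) ^ 2 + (th μ s : ℂ) ^ 2 = 1 := by
  exact_mod_cast sech_sq_add_th_sq μ s

theorem hasDerivAt_inv_sech (μ s : ℝ) :
    HasDerivAt (fun s => ((sech μ s)⁻¹ : ℂ)) (μ * th μ s * (sech μ s : ℂ)⁻¹) s := by
  have hs : (sech μ s : ℂ) ≠ 0 := by exact_mod_cast (sech_pos μ s).ne'
  refine ((hasDerivAt_sech_ofReal μ s).inv hs).congr_deriv ?_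
  field_simp

/-- The Darboux transform `y' + μ tanh(μ s) y` of a bounded solution of
`y'' = (κ² - 2 μ² sech²(μ s)) y` is a bounded solution of `ζ'' = κ² ζ`. -/
theorem darboux (h : ∀ s, HasDerivAt y (y' s) s)
    (h' : ∀ s, HasDerivAt y' ((κ ^ 2 - 2 * μ ^ 2 * sech μ s ^ 2) * y s) s)
    (hC : ∀ s, ‖y s‖ ≤ C) :
    (∀ s, HasDerivAt (fun s => y' s + μ * th μ s * y s)
      (μ * th μ s * (y' s + μ * th μ s * y s) + (κ ^ 2 - μ ^ 2) * y s) s) ∧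
    (∀ s, HasDerivAt
      (fun s => μ * th μ s * (y' s + μ * th μ s * y s) + (κ ^ 2 - μ ^ 2) * y s)
      (κ ^ 2 * (y' s + μ * th μ s * y s)) s) ∧
    ∃ B, ∀ s, ‖y' s + μ * th μ s * y s‖ ≤ B := by
  have h1 : ∀ s, HasDerivAt (fun s => y' s + μ * th μ s * y s)
      (μ * th μ s * (y' s + μ * th μ s * y s) + (κ ^ 2 - μ ^ 2) * y s) s := fun s => by
    refine ((h' s).add (((hasDerivAt_th_ofReal μ s).const_mul (μ : ℂ)).mul (h s))).congr_deriv ?_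
    linear_combination (-μ ^ 2 * y s) * sech_sq_add_th_sq_ofReal μ s
  refine ⟨h1, fun s => ?_, ?_⟩
  · refine ((((hasDerivAt_th_ofReal μ s).const_mul (μ : ℂ)).mul (h1 s)).add
      ((h s).const_mul _)).congr_deriv ?_
    linear_combination (μ ^ 2 * (y' s + μ * th μ s * y s)) * sech_sq_add_th_sq_ofReal μ s
  · have hC0 : 0 ≤ C := (norm_nonneg _).trans (hC 0)
    have hD : ∀ s, ‖((κ : ℂ) ^ 2 - 2 * μ ^ 2 * sech μ s ^ 2) * y s‖ ≤
        (κ ^ 2 + 2 * μ ^ 2) * C := fun s => by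
      have e : ((κ : ℂ) ^ 2 - 2 * μ ^ 2 * sech μ s ^ 2) =
          ((κ ^ 2 - 2 * μ ^ 2 * sech μ s ^ 2 : ℝ) : ℂ) := by push_cast; rfl
      rw [norm_mul, e, Complex.norm_real, Real.norm_eq_abs]
      have hs : sech μ s ^ 2 ≤ 1 := by nlinarith [sech_sq_add_th_sq μ s, sq_nonneg (th μ s)]
      refine mul_le_mul (abs_le.2 ⟨?_, ?_⟩) (hC s) (norm_nonneg _) (by positivity) <;>
        nlinarith [sq_nonneg κ, sq_nonneg μ, sq_nonneg (μ * sech μ s),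
          mul_le_mul_of_nonneg_left hs (sq_nonneg μ)]
    refine ⟨(2 * C + (κ ^ 2 + 2 * μ ^ 2) * C) + |μ| * C, fun s => ?_⟩
    refine (norm_add_le _ _).trans (add_le_add (norm_deriv_le_of_bounded h h' hC hD s) ?_)
    rw [norm_mul, norm_mul, Complex.norm_real, Complex.norm_real, Real.norm_eq_abs,
      Real.norm_eq_abs]
    have := abs_th_le_one μ s
    calc |μ| * |th μ s| * ‖y s‖ ≤ |μ| * 1 * C := by
          gcongr
          exact hC s
      _ = |μ| * C := by ring

/-- For κ = 0 the Darboux transform ζ is affine, and boundedness makes it constant. Then ζ' = μ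
tanh(μ s) ζ - μ² y vanishes, which solves for y algebraically. -/
theorem bounded_solution_normal_zero (hμ : μ ≠ 0) (h : ∀ s, HasDerivAt y (y' s) s)
    (h' : ∀ s, HasDerivAt y' (-(2 * μ ^ 2 * sech μ s ^ 2) * y s) s)
    (hC : ∀ s, ‖y s‖ ≤ C) : ∃ c : ℂ, ∀ s, y s = c * th μ s := by
  obtain ⟨h1, h2, B, hB⟩ := darboux (κ := 0) (μ := μ) h (by simpa using h') hC
  set z : ℝ → ℂ := fun s => y' s + μ * th μ s * y s with hz
  have h3 := eq_of_hasDerivAt_zero fun s => (h2 s).congr_deriv (by simp)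
  set c : ℂ := (fun s => μ * th μ s * z s + (((0 : ℝ) : ℂ) ^ 2 - μ ^ 2) * y s) 0 with hc
  have h4 : ∀ s, HasDerivAt z c s := fun s => (h1 s).congr_deriv (h3 s)
  have h5 := eq_of_hasDerivAt_zero (f := fun s : ℝ => z s - c * s) fun s =>
    ((h4 s).sub ((Complex.ofRealCLM.hasDerivAt (x := s)).const_mul c)).congr_deriv (by simp)
  have h6 : ∀ s, z s = c * s + z 0 := fun s => by
    have := h5 s
    simp only [Complex.ofReal_zero, mul_zero, sub_zero] at this
    linear_combination this
  have hc0 : c = 0 := eq_zero_of_linear_bound (d := z 0) (C := B) fun s => by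
    rw [← h6]
    exact hB s
  have hμ' : (μ : ℂ) ≠ 0 := by exact_mod_cast hμ
  refine ⟨z 0 / μ, fun s => ?_⟩
  have h7 : μ * th μ s * z s + (((0 : ℝ) : ℂ) ^ 2 - μ ^ 2) * y s = 0 := (h3 s).trans hc0
  rw [h6 s, hc0] at h7
  simp only [Complex.ofReal_zero] at h7
  field_simp
  have h8 : (μ : ℂ) * (μ * y s - z 0 * th μ s) = 0 := by linear_combination -h7
  linear_combination (mul_eq_zero.1 h8).resolve_left hμ'

/-- The Darboux transform ζ is bounded with ζ'' = κ² ζ, so it is zero. Hence y' = -μ tanh(μ s) y,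
whose solutions are multiples of sech, and ζ' = 0 leaves (κ² - μ²) y = 0. -/
theorem bounded_solution_normal (hκ : κ ≠ 0) (h : ∀ s, HasDerivAt y (y' s) s)
    (h' : ∀ s, HasDerivAt y' ((κ ^ 2 - 2 * μ ^ 2 * sech μ s ^ 2) * y s) s)
    (hC : ∀ s, ‖y s‖ ≤ C) :
    (κ ^ 2 ≠ μ ^ 2 → ∀ s, y s = 0) ∧ ∃ c : ℂ, ∀ s, y s = c * sech μ s := by
  obtain ⟨h1, h2, B, hB⟩ := darboux h h' hC
  have hz := eq_zero_of_second_order (D := |μ| * B + ‖((κ : ℂ) ^ 2 - μ ^ 2)‖ * C) hκ h1 h2 hB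
    fun s => by
      refine (norm_add_le _ _).trans (add_le_add ?_ ?_)
      · rw [norm_mul, norm_mul, Complex.norm_real, Complex.norm_real, Real.norm_eq_abs,
          Real.norm_eq_abs]
        have := abs_th_le_one μ s
        calc |μ| * |th μ s| * ‖y' s + μ * th μ s * y s‖ ≤ |μ| * 1 * B := by
              gcongr
              exact hB s
          _ = |μ| * B := by ring
      · rw [norm_mul]
        exact mul_le_mul_of_nonneg_left (hC s) (norm_nonneg _)
  constructor
  · intro hne s
    have h3 := (h1 s).unique ((hasDerivAt_const s (0 : ℂ)).congr_of_eventuallyEq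
      (Filter.Eventually.of_forall hz))
    rw [hz s, mul_zero, zero_add] at h3
    refine (mul_eq_zero.1 h3).resolve_left ?_
    exact_mod_cast sub_ne_zero.2 hne
  · have h4 := eq_of_hasDerivAt_zero (f := fun s => y s * (sech μ s : ℂ)⁻¹) fun s => by
      refine ((h s).mul (hasDerivAt_inv_sech μ s)).congr_deriv ?_
      linear_combination (sech μ s : ℂ)⁻¹ * hz s
    refine ⟨y 0 * (sech μ 0 : ℂ)⁻¹, fun s => ?_⟩
    have hs : (sech μ s : ℂ) ≠ 0 := by exact_mod_cast (sech_pos μ s).ne'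
    rw [← h4 s]
    field_simp

theorem half_exp_le_inv_sech (μ s : ℝ) : Real.exp (μ * s) / 2 ≤ (sech μ s)⁻¹ := by
  rw [sech, inv_inv, Real.cosh_eq]
  linarith [Real.exp_pos (-(μ * s))]

theorem exp_neg_le_sech (μ s : ℝ) : Real.exp (-(|μ| * |s|)) ≤ sech μ s := by
  rw [sech, ← abs_mul, Real.exp_neg]
  refine inv_anti₀ (Real.cosh_pos _) ?_
  rw [Real.cosh_eq]
  have h1 := Real.exp_le_exp.2 (le_abs_self (μ * s))
  have h2 := Real.exp_le_exp.2 (neg_le_abs (μ * s))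
  linarith

/-- Bounded solutions of the mode equation for the tangential component. -/
theorem bounded_solution_tangential (hμ : μ ≠ 0) (h : ∀ s, HasDerivAt y (y' s) s)
    (h' : ∀ s, HasDerivAt y' (((κ - μ * th μ s) ^ 2 - μ ^ 2 * sech μ s ^ 2) * y s) s)
    (hC : ∀ s, ‖y s‖ ≤ C) :
    (|μ| < |κ| → ∀ s, y s = 0) ∧
      ∃ d : ℂ, ∀ s, y s = d * ((Real.exp (κ * s) : ℝ) : ℂ) * sech μ s := by
  have hC0 : 0 ≤ C := (norm_nonneg _).trans (hC 0)
  have hcoef : ∀ s, |κ - μ * th μ s| ≤ |κ| + |μ| := fun s => by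
    refine (abs_sub _ _).trans (add_le_add le_rfl ?_)
    rw [abs_mul]
    exact mul_le_of_le_one_right (abs_nonneg _) (abs_th_le_one μ s)
  have hD : ∀ s, ‖(((κ : ℂ) - μ * th μ s) ^ 2 - μ ^ 2 * sech μ s ^ 2) * y s‖ ≤
      ((|κ| + |μ|) ^ 2 + μ ^ 2) * C := fun s => by
    have e : (((κ : ℂ) - μ * th μ s) ^ 2 - μ ^ 2 * sech μ s ^ 2) =
        (((κ - μ * th μ s) ^ 2 - μ ^ 2 * sech μ s ^ 2 : ℝ) : ℂ) := by push_cast; rfl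
    rw [norm_mul, e, Complex.norm_real, Real.norm_eq_abs]
    have hs : sech μ s ^ 2 ≤ 1 := by nlinarith [sech_sq_add_th_sq μ s, sq_nonneg (th μ s)]
    have hq : (κ - μ * th μ s) ^ 2 ≤ (|κ| + |μ|) ^ 2 := by
      rw [← sq_abs]
      exact pow_le_pow_left₀ (abs_nonneg _) (hcoef s) 2
    refine mul_le_mul (abs_le.2 ⟨?_, ?_⟩) (hC s) (norm_nonneg _) (by positivity) <;>
      nlinarith [sq_nonneg (κ - μ * th μ s), sq_nonneg μ, sq_nonneg (μ * sech μ s),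
        mul_le_mul_of_nonneg_left hs (sq_nonneg μ), sq_nonneg (|κ| + |μ|)]
  -- With g = κ - μ tanh(μ s) one has g' = -μ² sech²(μ s), so the equation is (∂ + g)(∂ - g) y = 0
  -- and v = y' - g y satisfies v' = -g v.
  set v : ℝ → ℂ := fun s => y' s - (κ - μ * th μ s) * y s with hv
  have hvB : ∀ s, ‖v s‖ ≤ (2 * C + ((|κ| + |μ|) ^ 2 + μ ^ 2) * C) + (|κ| + |μ|) * C := fun s => by
    refine (norm_sub_le _ _).trans (add_le_add (norm_deriv_le_of_bounded h h' hC hD s) ?_)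
    have e : ((κ : ℂ) - μ * th μ s) = ((κ - μ * th μ s : ℝ) : ℂ) := by push_cast; rfl
    rw [norm_mul, e, Complex.norm_real, Real.norm_eq_abs]
    exact mul_le_mul (hcoef s) (hC s) (norm_nonneg _) (by positivity)
  have hv' : ∀ s, HasDerivAt v (-(κ - μ * th μ s) * v s) s := fun s => by
    refine ((h' s).sub ((((hasDerivAt_th_ofReal μ s).const_mul (μ : ℂ)).const_sub (κ : ℂ)).mul
      (h s))).congr_deriv ?_
    simp only [hv]
    ring
  have h1 := eq_of_hasDerivAt_zero
    (f := fun s => v s * (((Real.exp (κ * s) : ℝ) : ℂ) * sech μ s)) fun s => by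
      refine ((hv' s).mul ((hasDerivAt_exp_mul κ s).mul
        (hasDerivAt_sech_ofReal μ s))).congr_deriv ?_
      simp only [Pi.mul_apply]
      ring
  have h2 : ∀ s, ‖v s‖ = ‖v 0 * (((Real.exp (κ * 0) : ℝ) : ℂ) * sech μ 0)‖ *
      (Real.exp (-κ * s) * (sech μ s)⁻¹) := fun s => by
    rw [← h1 s, norm_mul, norm_mul, Complex.norm_real, Complex.norm_real, Real.norm_eq_abs,
      Real.norm_eq_abs, Real.abs_exp, abs_of_pos (sech_pos μ s), neg_mul, Real.exp_neg]
    have := (sech_pos μ s).ne'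
    field_simp
  -- Here v is a multiple of e^{-κ s} cosh(μ s), and cosh(μ s) is at least half of e^{ν s} for ν =
  -- ±μ. Since μ ≠ 0, one of the two signs has ν ≠ κ, and then v is unbounded at one end unless it
  -- vanishes.
  have h3 : ∀ ν : ℝ, (∀ s, Real.exp (ν * s) / 2 ≤ (sech μ s)⁻¹) → ν - κ ≠ 0 →
      v 0 * (((Real.exp (κ * 0) : ℝ) : ℂ) * sech μ 0) = 0 := fun ν hν hne => by
    refine eq_zero_of_exp_bound_line
      (C := 2 * ((2 * C + ((|κ| + |μ|) ^ 2 + μ ^ 2) * C) + (|κ| + |μ|) * C)) hne fun s => ?_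
    have e : Real.exp ((ν - κ) * s) = Real.exp (-κ * s) * Real.exp (ν * s) := by
      rw [← Real.exp_add]
      congr 1
      ring
    have := hvB s
    rw [h2] at this
    rw [e]
    have h5 := mul_le_mul_of_nonneg_left (hν s) (mul_nonneg
      (norm_nonneg (v 0 * (((Real.exp (κ * 0) : ℝ) : ℂ) * sech μ 0))) (Real.exp_pos (-κ * s)).le)
    linarith
  have h4 : v 0 * (((Real.exp (κ * 0) : ℝ) : ℂ) * sech μ 0) = 0 := by
    by_cases hk : μ - κ = 0
    · refine h3 (-μ) (fun s => ?_) fun h => hμ (by linarith)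
      rw [← sech_neg]
      exact half_exp_le_inv_sech (-μ) s
    · exact h3 μ (half_exp_le_inv_sech μ) hk
  have hv0 : ∀ s, v s = 0 := fun s => by
    have := h2 s
    rw [h4, norm_zero, zero_mul] at this
    exact norm_eq_zero.1 this
  have h5 := eq_of_hasDerivAt_zero
    (f := fun s => y s * (((Real.exp (-κ * s) : ℝ) : ℂ) * (sech μ s : ℂ)⁻¹)) fun s => by
      refine ((h s).mul ((hasDerivAt_exp_mul (-κ) s).mul
        (hasDerivAt_inv_sech μ s))).congr_deriv ?_
      simp only [Pi.mul_apply]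
      push_cast
      linear_combination (Complex.exp (-κ * s) * (sech μ s : ℂ)⁻¹) * hv0 s
  obtain ⟨d, hd⟩ : ∃ d : ℂ, ∀ s, y s = d * ((Real.exp (κ * s) : ℝ) : ℂ) * sech μ s := by
    refine ⟨y 0 * (((Real.exp (-κ * 0) : ℝ) : ℂ) * (sech μ 0 : ℂ)⁻¹), fun s => ?_⟩
    have hs : (sech μ s : ℂ) ≠ 0 := by exact_mod_cast (sech_pos μ s).ne'
    have he : ((Real.exp (-κ * s) : ℝ) : ℂ) * ((Real.exp (κ * s) : ℝ) : ℂ) = 1 := by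
      rw [← Complex.ofReal_mul, ← Real.exp_add]
      simp
    have hi := inv_mul_cancel₀ hs
    rw [← h5 s]
    linear_combination -y s * he - y s * ((Real.exp (-κ * s) : ℝ) : ℂ) *
      ((Real.exp (κ * s) : ℝ) : ℂ) * hi
  refine ⟨fun hlt s => ?_, d, hd⟩
  have hd0 : d = 0 := by
    have hn : ∀ s, ‖d‖ * (Real.exp (κ * s) * Real.exp (-(|μ| * |s|))) ≤ C := fun s => by
      refine le_trans ?_ (hC s)
      rw [hd, norm_mul, norm_mul, Complex.norm_real, Complex.norm_real, Real.norm_eq_abs,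
        Real.norm_eq_abs, Real.abs_exp, abs_of_pos (sech_pos μ s), mul_assoc]
      gcongr
      exact exp_neg_le_sech μ s
    -- Towards the end where κ s = |κ| |s|, the solution has size at least ‖d‖ e^{(|κ| - |μ|) |s|}.
    refine eq_zero_of_exp_bound (a := |κ| - |μ|) (C := C) (by linarith) fun s hs => ?_
    rcases abs_cases κ with ⟨hk, -⟩ | ⟨hk, -⟩
    · convert hn s using 2
      rw [← Real.exp_add, abs_of_nonneg hs, hk]
      congr 1
      ring
    · convert hn (-s) using 2
      rw [← Real.exp_add, abs_neg, abs_of_nonneg hs, hk]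
      congr 1
      ring
  rw [hd, hd0]
  simp

end ODE

/-! ### From modes to the components of a bounded solution -/

theorem polarPt_add_two_pi (r t : ℝ) : polarPt r (t + 2 * Real.pi) = polarPt r t := by
  have : ((t + 2 * Real.pi : ℝ) : ℂ) * Complex.I = t * Complex.I + 2 * Real.pi * Complex.I := by
    push_cast
    ring
  rw [polarPt, this, Complex.exp_periodic, polarPt]

theorem cos_int_mul_add (m : ℤ) (t : ℝ) :
    Real.cos (m * (t + 2 * Real.pi)) = Real.cos (m * t) := by
  rw [mul_add, Real.cos_add_int_mul_two_pi]

theorem sin_int_mul_add (m : ℤ) (t : ℝ) :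
    Real.sin (m * (t + 2 * Real.pi)) = Real.sin (m * t) := by
  rw [mul_add, Real.sin_add_int_mul_two_pi]

/-- Fourier modes of a periodic solution of `u_ss + u_tt = a(s) u + b(s) u_t` solve
`y'' = (a + i k b + k²) y`. -/
theorem mode_equation {u us ut uss utt : ℝ → ℝ → ℂ} (hJ : IsJet u us ut uss utt)
    (hper : ∀ s, Function.Periodic (u s) (2 * Real.pi)) {a b : ℝ → ℂ}
    (heq : ∀ s t, uss s t + utt s t = a s * u s t + b s * ut s t) (k : ℤ) :
    (∀ s, HasDerivAt (mode u k) (mode us k s) s) ∧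
      ∀ s, HasDerivAt (mode us k) ((a s + k * Complex.I * b s + k ^ 2) * mode u k s) s := by
  refine ⟨hasDerivAt_mode hJ.s hJ.cont hJ.cont_s k, fun s => ?_⟩
  refine (hasDerivAt_mode hJ.ss hJ.cont_s hJ.cont_ss k s).congr_deriv ?_
  have hper0 : ∀ s, u s (2 * Real.pi) = u s 0 := fun s => by simpa using hper s 0
  have hper1 : ∀ s, ut s (2 * Real.pi) = ut s 0 := fun s => by
    simpa using hasDerivAt_periodic (hJ.t s) (hper s) 0
  have h1 := mode_deriv_t hJ.t hJ.cont hJ.cont_t hper0 k s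
  have h2 := mode_deriv_t hJ.tt hJ.cont_t hJ.cont_tt hper1 k s
  have i0 := (continuous_mode_integrand hJ.cont k s).intervalIntegrable (μ := MeasureTheory.volume)
    0 (2 * Real.pi)
  have i1 := (continuous_mode_integrand hJ.cont_t k s).intervalIntegrable
    (μ := MeasureTheory.volume) 0 (2 * Real.pi)
  have i2 := (continuous_mode_integrand hJ.cont_tt k s).intervalIntegrable
    (μ := MeasureTheory.volume) 0 (2 * Real.pi)
  have h3 : mode uss k s = a s * mode u k s + b s * mode ut k s - mode utt k s := by
    unfold mode
    rw [← intervalIntegral.integral_const_mul, ← intervalIntegral.integral_const_mul,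
      ← intervalIntegral.integral_add (i0.const_mul _) (i1.const_mul _),
      ← intervalIntegral.integral_sub ((i0.const_mul _).add (i1.const_mul _)) i2]
    refine intervalIntegral.integral_congr fun t _ => ?_
    linear_combination Complex.exp (-(k * t) * Complex.I) * heq s t
  rw [h3, h2, h1]
  linear_combination (-(k : ℂ) ^ 2 * mode u k s) * Complex.I_sq

theorem exp_mul_I_eq (x : ℝ) :
    Complex.exp (x * Complex.I) = (Real.cos x : ℂ) + (Real.sin x : ℂ) * Complex.I := by
  rw [Complex.exp_mul_I, Complex.ofReal_cos, Complex.ofReal_sin]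

theorem exp_int_mul_I_eq (k : ℤ) (t : ℝ) : Complex.exp (k * t * Complex.I) =
    (Real.cos (k * t) : ℂ) + (Real.sin (k * t) : ℂ) * Complex.I := by
  rw [← exp_mul_I_eq]
  push_cast
  rfl

theorem abs_mul_le_of_le_one {a b C : ℝ} (ha : |a| ≤ C) (hb : |b| ≤ 1) : |a * b| ≤ C := by
  rw [abs_mul]
  exact (mul_le_of_le_one_right (abs_nonneg a) hb).trans ha

theorem abs_sech_le_one (μ s : ℝ) : |sech μ s| ≤ 1 := by
  rw [abs_of_pos (sech_pos μ s)]
  exact sech_le_one μ s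

theorem abs_mul_le_one {a b : ℝ} (ha : |a| ≤ 1) (hb : |b| ≤ 1) : |a * b| ≤ 1 :=
  abs_mul_le_of_le_one ha hb

variable {m : ℤ} {F Fs Ft Fss Ftt : ℝ → ℝ → Fin 3 → ℝ}

/-- The component along the bubble of a bounded solution. -/
theorem normal_component (hm : m ≠ 0) (hJ : IsJet F Fs Ft Fss Ftt)
    (heq : ∀ s t, Fss s t + Ftt s t =
      (2 : ℝ) • (bubS m s t ⨯₃ Ft s t + Fs s t ⨯₃ bubT m s t))
    (hper : ∀ s, Function.Periodic (F s) (2 * Real.pi)) {C : ℝ} (hC : ∀ s t, ‖F s t‖ ≤ C) :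
    ∃ A B D : ℝ, ∀ s t,
      F s t 0 * bub m s t 0 + F s t 1 * bub m s t 1 + F s t 2 * bub m s t 2 =
        A * th m s + sech m s * (B * Real.cos (m * t) + D * Real.sin (m * t)) := by
  obtain ⟨us, ut, uss, utt, hu, hue⟩ := normal_equation hJ heq
  set u : ℝ → ℝ → ℝ := fun s t =>
    F s t 0 * bub m s t 0 + F s t 1 * bub m s t 1 + F s t 2 * bub m s t 2 with hudef
  have hm' : (m : ℝ) ≠ 0 := by exact_mod_cast hm
  have huC : ∀ s t, ‖((u s t : ℝ) : ℂ)‖ ≤ 3 * C := fun s t => by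
    have hF := fun i => (norm_le_pi_norm (F s t) i).trans (hC s t)
    simp only [Real.norm_eq_abs] at hF
    rw [Complex.norm_real, Real.norm_eq_abs]
    refine (abs_add_three _ _ _).trans ?_
    have a0 := abs_mul_le_of_le_one (hF 0) (b := bub m s t 0)
      (abs_mul_le_one (abs_sech_le_one m s) (Real.abs_cos_le_one _))
    have a1 := abs_mul_le_of_le_one (hF 1) (b := bub m s t 1)
      (abs_mul_le_one (abs_sech_le_one m s) (Real.abs_sin_le_one _))
    have a2 := abs_mul_le_of_le_one (hF 2) (b := bub m s t 2) (abs_th_le_one m s)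
    linarith
  have huper : ∀ s, Function.Periodic (fun t => ((u s t : ℝ) : ℂ)) (2 * Real.pi) := fun s t => by
    simp only [hudef, bub, hper s t, cos_int_mul_add, sin_int_mul_add]
  have hcJ := hu.clm Complex.ofRealCLM
  simp only [Complex.ofRealCLM_apply] at hcJ
  have hmode := fun k => mode_equation hcJ huper (a := fun s => -2 * m ^ 2 * (sech m s : ℂ) ^ 2)
    (b := fun _ => 0) (fun s t => by
      have := hue s t
      rw [zero_mul, add_zero]
      exact_mod_cast this) k
  have hbd := fun k s => norm_mode_le huC k s
  have h0 : ∃ c : ℂ, ∀ s, mode (fun s t => ((u s t : ℝ) : ℂ)) 0 s = c * th m s :=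
    bounded_solution_normal_zero hm' (hmode 0).1 (fun s => ((hmode 0).2 s).congr_deriv (by
      push_cast
      ring)) (hbd 0)
  have hk : ∀ k : ℤ, k ≠ 0 → ((k : ℝ) ^ 2 ≠ (m : ℝ) ^ 2 →
      ∀ s, mode (fun s t => ((u s t : ℝ) : ℂ)) k s = 0) ∧
      ∃ c : ℂ, ∀ s, mode (fun s t => ((u s t : ℝ) : ℂ)) k s = c * sech m s := fun k hk =>
    bounded_solution_normal (by exact_mod_cast hk) (hmode k).1
      (fun s => ((hmode k).2 s).congr_deriv (by
        push_cast
        ring)) (hbd k)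
  obtain ⟨c0, h0⟩ := h0
  obtain ⟨c1, h1⟩ := (hk m hm).2
  obtain ⟨c2, h2⟩ := (hk (-m) (neg_ne_zero.2 hm)).2
  -- The modes 0, m, -m survive. The coefficients come from the real part of w c₀ tanh + sech (w c₁
  -- e^{imt} + w c₂ e^{-imt}), with w = 1 / 2π.
  refine ⟨(1 / (2 * Real.pi) * c0).re, (1 / (2 * Real.pi) * c1 + 1 / (2 * Real.pi) * c2).re,
    (1 / (2 * Real.pi) * c2 - 1 / (2 * Real.pi) * c1).im, fun s t => ?_⟩
  have hsum := eq_sum_modes (f := fun t => ((u s t : ℝ) : ℂ))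
    (continuous_slice (u := fun s t => ((u s t : ℝ) : ℂ)) hcJ.cont s) (huper s) {0, m, -m} (fun k hkK => by
      simp only [Finset.mem_insert, Finset.mem_singleton, not_or] at hkK
      refine (hk k hkK.1).1 (fun h => ?_) s
      rcases sq_eq_sq_iff_eq_or_eq_neg.1 h with h | h
      · exact hkK.2.1 (by exact_mod_cast h)
      · exact hkK.2.2 (by exact_mod_cast h)) t
  have n1 : (0 : ℤ) ∉ ({m, -m} : Finset ℤ) := by
    simp only [Finset.mem_insert, Finset.mem_singleton]
    lia
  have n2 : m ∉ ({-m} : Finset ℤ) := by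
    simp only [Finset.mem_singleton]
    lia
  have hm0 := h0 s
  have hm1 := h1 s
  have hm2 := h2 s
  unfold mode at hm0 hm1 hm2
  rw [Finset.sum_insert n1, Finset.sum_insert n2, Finset.sum_singleton, hm0, hm1, hm2,
    exp_int_mul_I_eq, exp_int_mul_I_eq, exp_int_mul_I_eq] at hsum
  have hre := congrArg Complex.re hsum
  rw [Complex.ofReal_re] at hre
  refine hre.trans ?_
  simp only [Int.cast_zero, Int.cast_neg, zero_mul, neg_mul, Real.cos_zero, Real.sin_zero,
    Real.cos_neg, Real.sin_neg]
  generalize (1 / (2 * Real.pi) : ℂ) = w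
  simp only [Complex.add_re, Complex.mul_re, Complex.mul_im, Complex.add_im, Complex.sub_im,
    Complex.ofReal_re, Complex.ofReal_im, Complex.I_re, Complex.I_im]
  ring

/-- The components along the frame of a bounded solution. -/
theorem tangential_component (hm : m ≠ 0) (hJ : IsJet F Fs Ft Fss Ftt)
    (heq : ∀ s t, Fss s t + Ftt s t =
      (2 : ℝ) • (bubS m s t ⨯₃ Ft s t + Fs s t ⨯₃ bubT m s t))
    (hper : ∀ s, Function.Periodic (F s) (2 * Real.pi)) {C : ℝ} (hC : ∀ s t, ‖F s t‖ ≤ C) :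
    ∃ a b : ℤ → ℝ, ∀ s t,
      F s t 0 * fr₁ m s t 0 + F s t 1 * fr₁ m s t 1 + F s t 2 * fr₁ m s t 2 =
        ∑ k ∈ Finset.Icc (-(m.natAbs : ℤ)) m.natAbs, -(sech m s * Real.exp (k * s) *
          (a k * Real.cos (k * t) - b k * Real.sin (k * t))) ∧
      F s t 0 * fr₂ m s t 0 + F s t 1 * fr₂ m s t 1 =
        ∑ k ∈ Finset.Icc (-(m.natAbs : ℤ)) m.natAbs, sech m s * Real.exp (k * s) *
          (a k * Real.sin (k * t) + b k * Real.cos (k * t)) := by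
  obtain ⟨ps, pt, pss, ptt, qs, qt, qss, qtt, hp, hq, hpe, hqe⟩ := tangential_equation hJ heq
  set p : ℝ → ℝ → ℝ := fun s t =>
    F s t 0 * fr₁ m s t 0 + F s t 1 * fr₁ m s t 1 + F s t 2 * fr₁ m s t 2 with hpdef
  set q : ℝ → ℝ → ℝ := fun s t => F s t 0 * fr₂ m s t 0 + F s t 1 * fr₂ m s t 1 with hqdef
  have hm' : (m : ℝ) ≠ 0 := by exact_mod_cast hm
  -- The combination -p + i q diagonalizes the coupling of p to q_t and of q to p_t, leaving one
  -- scalar complex equation.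
  have hcJ := (hp.clm (-Complex.ofRealCLM)).add
    (hq.clm (Complex.I • Complex.ofRealCLM))
  simp only [neg_apply, smul_apply, Complex.ofRealCLM_apply, smul_eq_mul] at hcJ
  set X : ℝ → ℝ → ℂ := fun s t => -((p s t : ℝ) : ℂ) + Complex.I * ((q s t : ℝ) : ℂ) with hX
  have hXC : ∀ s t, ‖X s t‖ ≤ 3 * C + 2 * C := fun s t => by
    have hF := fun i => (norm_le_pi_norm (F s t) i).trans (hC s t)
    simp only [Real.norm_eq_abs] at hF
    refine (norm_add_le _ _).trans (add_le_add ?_ ?_)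
    · rw [norm_neg, Complex.norm_real, Real.norm_eq_abs]
      refine (abs_add_three _ _ _).trans ?_
      have a0 := abs_mul_le_of_le_one (hF 0) (b := fr₁ m s t 0)
        (abs_mul_le_one (abs_th_le_one m s) (Real.abs_cos_le_one _))
      have a1 := abs_mul_le_of_le_one (hF 1) (b := fr₁ m s t 1)
        (abs_mul_le_one (abs_th_le_one m s) (Real.abs_sin_le_one _))
      have a2 := abs_mul_le_of_le_one (hF 2) (b := fr₁ m s t 2)
        ((abs_neg _).trans_le (abs_sech_le_one m s))
      linarith
    · rw [norm_mul, Complex.norm_I, one_mul, Complex.norm_real, Real.norm_eq_abs]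
      refine (abs_add_le _ _).trans ?_
      have a0 := abs_mul_le_of_le_one (hF 0) (b := fr₂ m s t 0)
        ((abs_neg _).trans_le (Real.abs_sin_le_one _))
      have a1 := abs_mul_le_of_le_one (hF 1) (b := fr₂ m s t 1) (Real.abs_cos_le_one _)
      linarith
  have hXper : ∀ s, Function.Periodic (X s) (2 * Real.pi) := fun s t => by
    simp only [hX, hpdef, hqdef, fr₁, fr₂, hper s t, cos_int_mul_add, sin_int_mul_add]
  have hmode := fun k => mode_equation hcJ hXper
    (a := fun s => m ^ 2 * ((th m s : ℂ) ^ 2 - (sech m s : ℂ) ^ 2))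
    (b := fun s => 2 * m * Complex.I * th m s) (fun s t => by
      have e1 : ((pss s t : ℝ) : ℂ) + ((ptt s t : ℝ) : ℂ) = m ^ 2 * ((th m s : ℂ) ^ 2 -
          (sech m s : ℂ) ^ 2) * ((p s t : ℝ) : ℂ) + 2 * m * th m s * ((qt s t : ℝ) : ℂ) := by
        exact_mod_cast hpe s t
      have e2 : ((qss s t : ℝ) : ℂ) + ((qtt s t : ℝ) : ℂ) = m ^ 2 * ((th m s : ℂ) ^ 2 -
          (sech m s : ℂ) ^ 2) * ((q s t : ℝ) : ℂ) - 2 * m * th m s * ((pt s t : ℝ) : ℂ) := by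
        exact_mod_cast hqe s t
      simp only [hX]
      linear_combination -e1 + Complex.I * e2 -
        2 * m * th m s * ((qt s t : ℝ) : ℂ) * Complex.I_sq) k
  have hsol := fun k : ℤ => bounded_solution_tangential (κ := k) hm' (hmode k).1
    (fun s => ((hmode k).2 s).congr_deriv (by
      push_cast
      linear_combination (2 * k * m * th m s * mode X k s) * Complex.I_sq))
    (fun s => norm_mode_le hXC k s)
  choose d hd using fun k => (hsol k).2
  refine ⟨fun k => (1 / (2 * Real.pi) * d k).re, fun k => (1 / (2 * Real.pi) * d k).im,
    fun s t => ?_⟩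
  have hsum := eq_sum_modes (f := X s) (continuous_slice hcJ.cont s) (hXper s)
    (Finset.Icc (-(m.natAbs : ℤ)) m.natAbs) (fun k hk => by
      refine (hsol k).1 ?_ s
      rw [Finset.mem_Icc, ← abs_le, Int.natCast_natAbs, not_le] at hk
      exact_mod_cast hk) t
  have hterm : ∀ k : ℤ, (1 / (2 * Real.pi) : ℂ) *
      (∫ t in (0 : ℝ)..(2 * Real.pi), Complex.exp (-(k * t) * Complex.I) * X s t) *
      Complex.exp (k * t * Complex.I) = ((sech m s * Real.exp (k * s) : ℝ) : ℂ) *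
      ((1 / (2 * Real.pi) * d k) * ((Real.cos (k * t) : ℂ) + Real.sin (k * t) * Complex.I)) :=
    fun k => by
      have := hd k s
      unfold mode at this
      rw [this, exp_int_mul_I_eq]
      push_cast
      ring
  rw [Finset.sum_congr rfl fun k _ => hterm k] at hsum
  have hre := congrArg Complex.re hsum
  have him := congrArg Complex.im hsum
  rw [Complex.re_sum] at hre
  rw [Complex.im_sum] at him
  have xre : (X s t).re = -p s t := by simp [hX]
  have xim : (X s t).im = q s t := by simp [hX]
  rw [xre] at hre
  rw [xim] at him
  constructor
  · rw [Finset.sum_neg_distrib]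
    refine (neg_eq_iff_eq_neg.1 hre).trans (congrArg Neg.neg (Finset.sum_congr rfl fun k _ => ?_))
    rw [Complex.re_ofReal_mul, Complex.mul_re]
    simp only [Complex.add_re, Complex.add_im, Complex.mul_re (Complex.ofReal _),
      Complex.mul_im (Complex.ofReal _), Complex.ofReal_re, Complex.ofReal_im, Complex.I_re,
      Complex.I_im]
    ring
  · refine him.trans (Finset.sum_congr rfl fun k _ => ?_)
    rw [Complex.im_ofReal_mul, Complex.mul_im]
    simp only [Complex.add_re, Complex.add_im, Complex.mul_re (Complex.ofReal _),
      Complex.mul_im (Complex.ofReal _), Complex.ofReal_re, Complex.ofReal_im, Complex.I_re,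
      Complex.I_im]
    ring

/-! ### Matching with the listed kernel functions -/

/-- Modes k ≤ 0 carry r^{-|k|} and feed the `lower` family, zero mode included; modes k ≥ 1 feed the
`upper` family, whose labels are shifted by one. -/
theorem sum_Icc_neg {M : Type*} [AddCommMonoid M] (f : ℤ → M) (n : ℕ) :
    ∑ k ∈ Finset.Icc (-(n : ℤ)) n, f k =
      ∑ j ∈ Finset.range (n + 1), f (-(j : ℤ)) + ∑ l ∈ Finset.range n, f ((l : ℤ) + 1) := by
  induction n with
  | zero => simp
  | succ n ih =>
    have h : Finset.Icc (-((n + 1 : ℕ) : ℤ)) ((n + 1 : ℕ) : ℤ) =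
        insert (-((n + 1 : ℕ) : ℤ)) (insert ((n : ℤ) + 1) (Finset.Icc (-(n : ℤ)) n)) := by
      ext k
      simp only [Finset.mem_insert, Finset.mem_Icc]
      lia
    rw [h, Finset.sum_insert (by simp only [Finset.mem_insert, Finset.mem_Icc]; lia),
      Finset.sum_insert (by simp only [Finset.mem_Icc]; lia), ih,
      Finset.sum_range_succ (fun j : ℕ => f (-(j : ℤ))) (n + 1),
      Finset.sum_range_succ (fun l : ℕ => f ((l : ℤ) + 1)) n]
    abel

/-- The bubble and the two frame vectors form an orthonormal basis of ℝ³; the third coordinate of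
the second frame vector is zero, hence its missing term. -/
theorem frame_expansion (m : ℤ) (s t : ℝ) (v : Fin 3 → ℝ) :
    v = (v 0 * bub m s t 0 + v 1 * bub m s t 1 + v 2 * bub m s t 2) • bub m s t +
      ((v 0 * fr₁ m s t 0 + v 1 * fr₁ m s t 1 + v 2 * fr₁ m s t 2) • fr₁ m s t +
        (v 0 * fr₂ m s t 0 + v 1 * fr₂ m s t 1) • fr₂ m s t) := by
  have hst := sech_sq_add_th_sq m s
  have hcs := Real.sin_sq_add_cos_sq (m * t)
  ext i
  fin_cases i <;> (simp [bub, fr₁, fr₂]; grind)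

theorem frame₁_exp (m : ℤ) (s t : ℝ) : frame₁ m (Real.exp s) t = fr₁ m s t := by
  rw [frame₁, fr₁, exp_zpow_two_mul, exp_zpow, sech_eq_exp, th_eq_exp]
  simp only [neg_mul, neg_div]

theorem sum_kernelIndex {M : Type*} [AddCommMonoid M] (n : ℕ) (f : KernelIndex n → M) :
    ∑ i, f i = f (.along 0) + f (.along 1) + f (.along 2) +
      (∑ k : Fin (n + 1), (f (.lower k 0) + f (.lower k 1)) +
        ∑ l : Fin n, (f (.upper l 0) + f (.upper l 1))) := by
  rw [← (KernelIndex.equivSum n).symm.sum_comp f, Fintype.sum_sum_type, Fintype.sum_sum_type,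
    Fintype.sum_prod_type, Fintype.sum_prod_type]
  simp only [Fin.sum_univ_three, Fin.sum_univ_two]
  rfl

theorem sech_natAbs (m : ℤ) (s : ℝ) : sech m.natAbs s = sech m s := by
  rcases Int.natAbs_eq m with h | h <;> conv_rhs => rw [h]
  · simp
  · rw [Int.cast_neg, Int.cast_natCast, sech_neg]

theorem exp_pow_natAbs_div (m : ℤ) (s : ℝ) :
    Real.exp s ^ m.natAbs / (1 + Real.exp s ^ (2 * m.natAbs)) = sech m s / 2 := by
  rw [← sech_natAbs, sech_eq_exp, mul_comm 2, pow_mul, ← Real.exp_nat_mul]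
  field_simp
  ring

theorem exp_pow_sub_div (m : ℤ) (s : ℝ) {k : ℕ} (hk : k ≤ m.natAbs) :
    Real.exp s ^ (m.natAbs - k) / (1 + Real.exp s ^ (2 * m.natAbs)) =
      sech m s * Real.exp (-(k : ℝ) * s) / 2 := by
  have h : Real.exp s ^ (m.natAbs - k) = Real.exp s ^ m.natAbs * Real.exp (-(k : ℝ) * s) := by
    rw [pow_sub₀ _ (Real.exp_pos s).ne' hk, ← Real.exp_nat_mul s k, ← Real.exp_neg]
    ring_nf
  rw [h, mul_div_right_comm, exp_pow_natAbs_div]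
  ring

theorem exp_pow_add_div (m : ℤ) (s : ℝ) (l : ℕ) :
    Real.exp s ^ (m.natAbs + l) / (1 + Real.exp s ^ (2 * m.natAbs)) =
      sech m s * Real.exp ((l : ℝ) * s) / 2 := by
  rw [pow_add, mul_div_right_comm, exp_pow_natAbs_div, Real.exp_nat_mul]
  ring

/-- The normal kernel functions use n = |m| while the computed solutions use m; σ is the sign that
the odd functions tanh and sine pick up. -/
theorem exists_sign (m : ℤ) : ∃ σ : ℝ, σ ^ 2 = 1 ∧
    (∀ s, th m.natAbs s = σ * th m s) ∧ (∀ t, Real.cos (m.natAbs * t) = Real.cos (m * t)) ∧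
    ∀ t, Real.sin (m.natAbs * t) = σ * Real.sin (m * t) := by
  rcases Int.natAbs_eq m with h | h
  · have h' : (m.natAbs : ℝ) = m := by
      conv_rhs => rw [h]
      simp
    exact ⟨1, by simp, by simp [h'], by simp [h'], by simp [h']⟩
  · have h' : (m.natAbs : ℝ) = -m := by
      conv_rhs => rw [h]
      rw [Int.cast_neg, Int.cast_natCast, neg_neg]
    exact ⟨-1, by simp, by simp [h', th_neg], by simp [h'], by simp [h']⟩

theorem exists_combination (hm : m ≠ 0) {φ : ℂ → Fin 3 → ℝ}
    (hφ : SolvesLinearized (bubble m) φ) (hb : IsBoundedMap φ) :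
    ∃ c : KernelIndex m.natAbs → ℝ, ∀ r > 0, ∀ θ : ℝ,
      φ (polarPt r θ) = ∑ i, c i • kernelFun m i r θ := by
  obtain ⟨Fs, Ft, Fss, Ftt, hJ, heq⟩ := linearized_polar hm hφ
  obtain ⟨C, hC⟩ := hb
  have hper : ∀ s, Function.Periodic (fun t => φ (polarPt (Real.exp s) t)) (2 * Real.pi) :=
    fun s t => by simp only [polarPt_add_two_pi]
  obtain ⟨A, B, D, hη⟩ := normal_component hm hJ heq hper fun s t => hC _
  obtain ⟨a, b, hpq⟩ := tangential_component hm hJ heq hper fun s t => hC _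
  obtain ⟨σ, hσ, hth, hcos, hsin⟩ := exists_sign m
  -- The factors 2 compensate rⁿ / (1 + r²ⁿ) = sech(ms) / 2, and σ converts tanh(ms) and sin(mθ) to
  -- their versions for n. The remaining signs come from X = -p + i q and, for `lower`, from k ↦ -k.
  refine ⟨fun
    | .along 0 => σ * A
    | .along 1 => 2 * B
    | .along 2 => 2 * σ * D
    | .lower k 0 => -2 * a (-(k : ℕ))
    | .lower k 1 => -2 * b (-(k : ℕ))
    | .upper l 0 => -2 * a ((l : ℕ) + 1)
    | .upper l 1 => 2 * b ((l : ℕ) + 1), fun r hr θ => ?_⟩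
  obtain ⟨s, rfl⟩ : ∃ s, r = Real.exp s := ⟨Real.log r, (Real.exp_log hr).symm⟩
  rw [frame_expansion m s θ (φ (polarPt (Real.exp s) θ)), hη, (hpq s θ).1, (hpq s θ).2,
    Finset.sum_smul, Finset.sum_smul, ← Finset.sum_add_distrib, sum_Icc_neg, sum_kernelIndex,
    ← Fin.sum_univ_eq_sum_range (fun j : ℕ => _ + _) (m.natAbs + 1),
    ← Fin.sum_univ_eq_sum_range (fun j : ℕ => _ + _) m.natAbs]
  have hfr₂ : frame₂ m (Real.exp s) θ = fr₂ m s θ := rfl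
  have hthn : (Real.exp s ^ (2 * m.natAbs) - 1) / (Real.exp s ^ (2 * m.natAbs) + 1) =
      σ * th m s := by
    rw [← hth, th_eq_exp, mul_comm 2, pow_mul, ← Real.exp_nat_mul]
  congr 1
  · simp only [kernelFun, hthn, exp_pow_natAbs_div, hcos, hsin, bubble_polarPt hm]
    rw [← bub]
    simp only [smul_smul, ← add_smul]
    congr 1
    linear_combination (-A * th m s - sech m s * D * Real.sin (m * θ)) * hσ
  congr 1
  · refine Finset.sum_congr rfl fun k _ => ?_
    simp only [kernelFun, frame₁_exp, hfr₂, exp_pow_sub_div m s (Nat.lt_succ_iff.1 k.2)]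
    push_cast
    simp only [neg_mul, Real.cos_neg, Real.sin_neg]
    module
  · refine Finset.sum_congr rfl fun l _ => ?_
    simp only [kernelFun, frame₁_exp, hfr₂, exp_pow_add_div]
    push_cast
    module

end HBubble

end

theorem theorem1p1 (m : ℤ) (hm : m ≠ 0) :
    HBubble.SolvesHSystem (HBubble.bubble m) ∧
    (∀ r > 0, ∀ θ : ℝ, HBubble.bubble m (HBubble.polarPt r θ) =
      ![2 * r ^ m * Real.cos (m * θ) / (r ^ (2 * m) + 1),
        2 * r ^ m * Real.sin (m * θ) / (r ^ (2 * m) + 1),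
        (r ^ (2 * m) - 1) / (r ^ (2 * m) + 1)]) ∧
    ∀ φ : ℂ → Fin 3 → ℝ,
      HBubble.SolvesLinearized (HBubble.bubble m) φ → HBubble.IsBoundedMap φ →
        ∃ c : HBubble.KernelIndex m.natAbs → ℝ, ∀ r > 0, ∀ θ : ℝ,
          φ (HBubble.polarPt r θ) = ∑ i, c i • HBubble.kernelFun m i r θ := by
  exact ⟨HBubble.bubble_solves hm, fun _ hr θ => HBubble.bubble_polar hm hr θ,
    fun _ hφ hb => HBubble.exists_combination hm hφ hb⟩
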